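/- Let $d\ge 1$ be an integer and let $1\le p\le\infty$ with $p\neq 2$. Let $\mathbb X=L^p(\mathbb T^d)$ (complex-valued, normalized Haar measure on $\mathbb T^d=(\mathbb R/\mathbb Z)^d$) if $p<\infty$, and $\mathbb X=C(\mathbb T^d)$ with the supremum norm if $p=\infty$. For $k\in\mathbb Z^d$ let $e_k(x)=e^{2\pi i k\cdot x}$ and let $e_k^*\in\mathbb X^*$ be the Fourier coefficient functional $e_k^*(g)=\int_{\mathbb T^d}g(t)e^{-2\pi i k\cdot t}\,dt$. For any biorthogonal system $\{e_k,e_k^*\}$ in a Banach space $\mathbb X$, a finite index set $A$ and $N\ge1$, put: - $P_Ax=\sum_{k\in A}e_k^*(x)e_k$ and $K_N=\sup\{\|P_A\|: |A|\le N\}$; - $\sigma_N(x)=\inf\{\|x-\sum_{k\in A}c_ke_k\|: |A|\le N,\ c_k\in\mathbb C\}$ and $\widetilde\sigma_N(x)=\inf\{\|x-P_Ax\|: |A|\le N\}$; - a greedy operator of order $N$ is any map $G:\mathbb X\to\mathbb X$ such that, for every $x$, $Gx=P_Ax$ for some $A$ with $|A|=N$ and $\min_{k\in A}|e_k^*(x)|\ge\max_{k\notin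 A}|e_k^*(x)|$; - $L_N$ (resp. $\widetilde L_N$) is the smallest number such that $\|x-Gx\|\le L_N\,\sigma_N(x)$ (resp. $\|x-Gx\|\le\widetilde L_N\,\widetilde\sigma_N(x)$) for all $x\in\mathbb X$ and all greedy operators $G$ of order $N$; - $L_N^*$ and $\widetilde L_N^*$ are the constants $L_N$ and $\widetilde L_N$ of the dual system $\{e_k^*,e_k\}$ in the closed linear span of $\{e_k^*\}$ in $\mathbb X^*$; - $D(N)=\sup\|\sum_{k\in A}\varepsilon_ke_k\|_{\mathbb X}$ and $D^*(N)=\sup\|\sum_{k\in A}\varepsilon_ke_k^*\|_{\mathbb X^*}$, both suprema over $|A|=N$ and scalars with $|\varepsilon_k|=1$, and $D(0)=D^*(0)=0$; - $T_N(\eta_1,\eta_2)=\sum_{j=1}^N\frac{\eta_1(j)}{j}\,(\eta_2(j)-\eta_2(j-1))$ and $OT_N(D,D^*)=\min\{T_N(D,D^*),T_N(D^*,D)\}$. Then, for the trigonometric system above, $$OT_N(D,D^*)\approx L_N\approx\widetilde L_N\approx K_N\approx L_N^*\approx\widetilde L_N^*\approx N^{|\frac1p-\frac12|}$$ (with $\frac1\infty=0$),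 where $A_N\approx B_N$ means that there are constants $0<c\le C<\infty$, independent of $N$ (they may depend on $p$ and $d$), with $cB_N\le A_N\le CB_N$ for all $N\ge1$. -/

import Mathlib

namespace GreedyApprox

open MeasureTheory

noncomputable section

/-! ### Systems `(e n, f n)` in a normed space

`e : ι → X` are the vectors of the system and `f : ι → StrongDual 𝕜 X` the coefficient
functionals; `ι` is any index set. All constants below take values in `ℝ`. -/

section Systems

variable {𝕜 ι X : Type*} [RCLike 𝕜] [NormedAddCommGroup X] [NormedSpace 𝕜 X]

/-- The projection `P_A x = ∑_{n ∈ A} f n x • e n`. -/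
def proj (e : ι → X) (f : ι → StrongDual 𝕜 X) (A : Finset ι) : X →L[𝕜] X :=
  ∑ n ∈ A, (f n).smulRight (e n)

/-- The error `σ_N(x)` of best `N`-term approximation. -/
def sigma (𝕜 : Type*) [RCLike 𝕜] [NormedSpace 𝕜 X] (e : ι → X) (N : ℕ) (x : X) : ℝ :=
  sInf {r : ℝ | ∃ (A : Finset ι) (c : ι → 𝕜), A.card ≤ N ∧ r = ‖x - ∑ n ∈ A, c n • e n‖}

/-- The error of best expansional `N`-term approximation. -/
def sigmaTilde (e : ι → X) (f : ι → StrongDual 𝕜 X) (N : ℕ) (x : X) : ℝ :=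
  sInf {r : ℝ | ∃ A : Finset ι, A.card ≤ N ∧ r = ‖x - proj e f A x‖}

/-- `A` is a greedy set for `x` of order `N`. -/
def IsGreedySet (f : ι → StrongDual 𝕜 X) (x : X) (N : ℕ) (A : Finset ι) : Prop :=
  A.card = N ∧ ∀ n ∈ A, ∀ m ∉ A, ‖f m x‖ ≤ ‖f n x‖

/-- `G` is a greedy operator of order `N` (in general neither linear nor continuous). -/
def IsGreedyOperator (e : ι → X) (f : ι → StrongDual 𝕜 X) (N : ℕ) (G : X → X) : Prop :=
  ∀ x, ∃ A : Finset ι, IsGreedySet f x N A ∧ G x = proj e f A x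

/-- The Lebesgue-type constant `L_N`: the smallest `C ≥ 0` with `‖x - G x‖ ≤ C σ_N(x)` for all `x`
and all greedy operators `G` of order `N`. The set of such `C` is closed, so that its infimum is
its least element whenever it is nonempty. (If it were empty, the value here would be `0`, which
a positive lower bound for `L_N` excludes.) -/
def lebesgueConst (e : ι → X) (f : ι → StrongDual 𝕜 X) (N : ℕ) : ℝ :=
  sInf {C : ℝ | 0 ≤ C ∧ ∀ G, IsGreedyOperator e f N G → ∀ x, ‖x - G x‖ ≤ C * sigma 𝕜 e N x}

/-- The expansional Lebesgue-type constant, with the expansional error in place of `σ_N`. -/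
def lebesgueConstTilde (e : ι → X) (f : ι → StrongDual 𝕜 X) (N : ℕ) : ℝ :=
  sInf {C : ℝ | 0 ≤ C ∧ ∀ G, IsGreedyOperator e f N G → ∀ x, ‖x - G x‖ ≤ C * sigmaTilde e f N x}

/-- The conditionality constant `K_N = sup {‖P_A‖ : |A| ≤ N}`. -/
def condConst (e : ι → X) (f : ι → StrongDual 𝕜 X) (N : ℕ) : ℝ :=
  sSup {r : ℝ | ∃ A : Finset ι, A.card ≤ N ∧ r = ‖proj e f A‖}

/-- The upper super-democracy parameter of a family of vectors: the supremum of
`‖∑_{n ∈ A} ε n • e n‖` over `|A| = N` and unimodular `ε`. It is at most `N * sup ‖e n‖`. For a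
system `(e, f)` one has `D = upperDemocracy 𝕜 e` and `D^* = upperDemocracy 𝕜 f`, the latter with
respect to the norm of the dual space. -/
def upperDemocracy (𝕜 : Type*) [RCLike 𝕜] [NormedSpace 𝕜 X] (e : ι → X) (N : ℕ) : ℝ :=
  sSup {r : ℝ | ∃ (A : Finset ι) (ε : ι → 𝕜), A.card = N ∧ (∀ n, ‖ε n‖ = 1) ∧
    r = ‖∑ n ∈ A, ε n • e n‖}

/-- The closed linear span of the coefficient functionals in the dual space. -/
abbrev dualSpace (f : ι → StrongDual 𝕜 X) : Submodule 𝕜 (StrongDual 𝕜 X) :=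
  (Submodule.span 𝕜 (Set.range f)).topologicalClosure

/-- The vectors of the dual system: the functionals `f n`, in `dualSpace f`. -/
def dualVec (f : ι → StrongDual 𝕜 X) (n : ι) : dualSpace f :=
  ⟨f n, Submodule.le_topologicalClosure _ (Submodule.subset_span ⟨n, rfl⟩)⟩

/-- The coefficient functionals of the dual system: evaluation at `e n`, on `dualSpace f`. -/
def dualCoef (e : ι → X) (f : ι → StrongDual 𝕜 X) (n : ι) : StrongDual 𝕜 (dualSpace f) :=
  (NormedSpace.inclusionInDoubleDual 𝕜 X (e n)).comp (dualSpace f).subtypeL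

/-- `L_N^*`: the constant `L_N` of the dual system, in the closed span of the functionals. -/
def dualLebesgueConst (e : ι → X) (f : ι → StrongDual 𝕜 X) (N : ℕ) : ℝ :=
  lebesgueConst (𝕜 := 𝕜) (X := dualSpace f) (dualVec f) (dualCoef e f) N

/-- The constant `lebesgueConstTilde` of the dual system, in the closed span of the functionals. -/
def dualLebesgueConstTilde (e : ι → X) (f : ι → StrongDual 𝕜 X) (N : ℕ) : ℝ :=
  lebesgueConstTilde (𝕜 := 𝕜) (X := dualSpace f) (dualVec f) (dualCoef e f) N

end Systems

/-! ### Sequences -/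

/-- `Δη(j) = η(j) - η(j-1)` for `j ≥ 1`, with the agreement that `η(0) = 0`. -/
def delta (η : ℕ → ℝ) (j : ℕ) : ℝ := if j ≤ 1 then η j else η j - η (j - 1)

/-- `T_N(η₁, η₂) = ∑_{j=1}^N (η₁(j) / j) Δη₂(j)`. -/
def sumT (η₁ η₂ : ℕ → ℝ) (N : ℕ) : ℝ := ∑ j ∈ Finset.Icc 1 N, η₁ j / j * delta η₂ j

/-- The minimum of `T_N(η₁, η₂)` and `T_N(η₂, η₁)`. -/
def minT (η₁ η₂ : ℕ → ℝ) (N : ℕ) : ℝ := min (sumT η₁ η₂ N) (sumT η₂ η₁ N)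

/-- `A_N ≈ B_N`: two-sided bounds with positive constants independent of `N = 1, 2, …`. -/
def Approx (A B : ℕ → ℝ) : Prop :=
  ∃ c C : ℝ, 0 < c ∧ 0 < C ∧ ∀ N : ℕ, 1 ≤ N → c * B N ≤ A N ∧ A N ≤ C * B N

/-! ### The trigonometric system on the torus `(ℝ / ℤ)^d`

The exponential `x ↦ exp (2 π i k · x)` is `UnitAddTorus.mFourier k`, for `k : Fin d → ℤ`. -/

/-- The normalized Haar measure on the torus. -/
abbrev torusMeasure (d : ℕ) : Measure (UnitAddTorus (Fin d)) :=
  Measure.pi fun _ => AddCircle.haarAddCircle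

/-- `L^p` of the torus, with complex values. -/
abbrev TorusLp (d : ℕ) (p : ENNReal) : Type := Lp ℂ p (torusMeasure d)

/-- The continuous complex functions on the torus, with the supremum norm. -/
abbrev TorusC (d : ℕ) : Type := C(UnitAddTorus (Fin d), ℂ)

/-- The trigonometric system in `L^p`. -/
def trigLp (d : ℕ) (p : ENNReal) [Fact (1 ≤ p)] (k : Fin d → ℤ) : TorusLp d p :=
  ContinuousMap.toLp p (torusMeasure d) ℂ (UnitAddTorus.mFourier k)

/-- The trigonometric system in the continuous functions. -/
def trigC (d : ℕ) (k : Fin d → ℤ) : TorusC d := UnitAddTorus.mFourier k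

theorem integrable_coef (d : ℕ) (p : ENNReal) [hp : Fact (1 ≤ p)] (k : Fin d → ℤ)
    (g : TorusLp d p) :
    Integrable (fun t => UnitAddTorus.mFourier (-k) t * g t) (torusMeasure d) := by
  have hg : Integrable g (torusMeasure d) := (Lp.memLp g).integrable hp.out
  refine hg.bdd_mul (c := 1) ?_ ?_
  · exact (UnitAddTorus.mFourier (-k)).continuous.aestronglyMeasurable
  · refine Filter.Eventually.of_forall fun t => ?_
    exact ((UnitAddTorus.mFourier (-k)).norm_coe_le_norm t).trans
      UnitAddTorus.mFourier_norm.le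

theorem norm_mFourier_apply (d : ℕ) (k : Fin d → ℤ) (t : UnitAddTorus (Fin d)) :
    ‖UnitAddTorus.mFourier k t‖ = 1 := by
  rw [UnitAddTorus.mFourier, ContinuousMap.coe_mk, norm_prod]
  exact Finset.prod_eq_one fun i _ => by rw [fourier_apply, Circle.norm_coe]

/-- The Fourier coefficient `g ↦ ∫ exp (-2 π i k · t) g(t) dt` as a bounded functional on `L^p`. -/
def coefLp (d : ℕ) (p : ENNReal) [hp : Fact (1 ≤ p)] (k : Fin d → ℤ) :
    StrongDual ℂ (TorusLp d p) :=
  LinearMap.mkContinuous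
    { toFun := fun g => ∫ t, UnitAddTorus.mFourier (-k) t * g t ∂(torusMeasure d)
      map_add' := fun g h => by
        rw [← integral_add (integrable_coef d p k g) (integrable_coef d p k h)]
        refine integral_congr_ae ?_
        filter_upwards [Lp.coeFn_add g h] with t ht
        rw [ht, Pi.add_apply, mul_add]
      map_smul' := fun c g => by
        rw [RingHom.id_apply, smul_eq_mul, ← integral_const_mul]
        refine integral_congr_ae ?_
        filter_upwards [Lp.coeFn_smul c g] with t ht
        rw [ht, Pi.smul_apply, smul_eq_mul]
        ring }
    1 (fun g => by
      rw [one_mul]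
      have h1 : ‖∫ t, UnitAddTorus.mFourier (-k) t * g t ∂(torusMeasure d)‖
          ≤ ∫ t, ‖g t‖ ∂(torusMeasure d) := by
        refine (norm_integral_le_integral_norm _).trans (le_of_eq ?_)
        simp only [norm_mul, norm_mFourier_apply, one_mul]
      refine h1.trans ?_
      rw [integral_norm_eq_lintegral_enorm (Lp.aestronglyMeasurable g), Lp.norm_def,
        ← eLpNorm_one_eq_lintegral_enorm]
      exact ENNReal.toReal_mono (Lp.eLpNorm_ne_top g)
        (eLpNorm_le_eLpNorm_of_exponent_le hp.out (Lp.aestronglyMeasurable g)))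

/-- The Fourier coefficient `g ↦ ∫ exp (-2 π i k · t) g(t) dt` as a bounded functional on the
continuous functions. -/
def coefC (d : ℕ) (k : Fin d → ℤ) : StrongDual ℂ (TorusC d) :=
  LinearMap.mkContinuous
    { toFun := fun g => ∫ t, UnitAddTorus.mFourier (-k) t * g t ∂(torusMeasure d)
      map_add' := fun g h => by
        have hi : ∀ u : TorusC d,
            Integrable (fun t => UnitAddTorus.mFourier (-k) t * u t) (torusMeasure d) := fun u =>
          (UnitAddTorus.mFourier (-k) * u).continuous.integrable_of_hasCompactSupport
            (HasCompactSupport.of_compactSpace _)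
        rw [← integral_add (hi g) (hi h)]
        simp only [ContinuousMap.add_apply, mul_add]
      map_smul' := fun c g => by
        rw [RingHom.id_apply, smul_eq_mul, ← integral_const_mul]
        congr 1
        ext t
        rw [ContinuousMap.smul_apply, smul_eq_mul]
        ring }
    1 (fun g => by
      rw [one_mul]
      have h := norm_integral_le_of_norm_le_const (μ := torusMeasure d)
        (f := fun t => UnitAddTorus.mFourier (-k) t * g t) (C := ‖g‖)
        (Filter.Eventually.of_forall fun t => by
          rw [norm_mul, norm_mFourier_apply, one_mul]
          exact g.norm_coe_le_norm t)
      simpa using h)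

end

end GreedyApprox

namespace GreedyApprox

/-! ### The sums `T_N` of power-like sequences -/

section Sums

open Finset

theorem sum_delta (η : ℕ → ℝ) {N : ℕ} (hN : 1 ≤ N) : ∑ j ∈ Icc 1 N, delta η j = η N := by
  induction N, hN using Nat.le_induction with
  | base => simp [delta]
  | succ n hn ih =>
    rw [sum_Icc_succ_top (by omega), ih, delta, if_neg (by omega)]
    simp

theorem delta_nonneg {η : ℕ → ℝ} (h1 : 0 ≤ η 1) (hm : ∀ j : ℕ, 1 ≤ j → η j ≤ η (j + 1)) {j : ℕ}
    (hj : 1 ≤ j) : 0 ≤ delta η j := by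
  rcases hj.eq_or_lt with rfl | hj'
  · simpa [delta] using h1
  · rw [delta, if_neg (by omega)]
    obtain ⟨i, rfl⟩ : ∃ i, j = i + 1 := ⟨j - 1, by omega⟩
    simpa using hm i (by omega)

theorem rpow_succ_sub_rpow_le {b : ℝ} (hb1 : b ≤ 1) {n : ℕ} (hn : 1 ≤ n) :
    ((n + 1 : ℕ) : ℝ) ^ b - (n : ℝ) ^ b ≤ ((n + 1 : ℕ) : ℝ) ^ (b - 1) := by
  have h0 : (0 : ℝ) < n := by exact_mod_cast hn
  have h1 : (0 : ℝ) < ((n + 1 : ℕ) : ℝ) := by positivity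
  have h2 : ((n + 1 : ℕ) : ℝ) ^ (b - 1) ≤ (n : ℝ) ^ (b - 1) :=
    Real.rpow_le_rpow_of_nonpos h0 (by push_cast; linarith) (by linarith)
  have h3 : ((n + 1 : ℕ) : ℝ) ^ b = ((n + 1 : ℕ) : ℝ) ^ (b - 1) * (n + 1) := by
    rw [Real.rpow_sub_one h1.ne']
    push_cast
    field_simp
  have h4 : (n : ℝ) ^ b = (n : ℝ) ^ (b - 1) * n := by
    rw [Real.rpow_sub_one h0.ne']
    field_simp
  rw [h3, h4]
  nlinarith

theorem sum_rpow_sub_one_le {r : ℝ} (hr : 0 < r) (hr1 : r ≤ 1) (N : ℕ) :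
    ∑ j ∈ Icc 1 N, (j : ℝ) ^ (r - 1) ≤ (N : ℝ) ^ r / r := by
  induction N with
  | zero => simp [Real.zero_rpow hr.ne']
  | succ n ih =>
    rw [sum_Icc_succ_top (by omega)]
    have h1 : (0 : ℝ) < ((n + 1 : ℕ) : ℝ) := by positivity
    have h2 : (1 + -(1 / ((n + 1 : ℕ) : ℝ))) ^ r ≤ 1 + r * -(1 / ((n + 1 : ℕ) : ℝ)) := by
      refine rpow_one_add_le_one_add_mul_self ?_ hr.le hr1
      rw [neg_le_neg_iff, div_le_one h1]
      push_cast
      linarith [(Nat.cast_nonneg n : (0 : ℝ) ≤ n)]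
    have h3 : (n : ℝ) ^ r = ((n + 1 : ℕ) : ℝ) ^ r * (1 + -(1 / ((n + 1 : ℕ) : ℝ))) ^ r := by
      rw [← Real.mul_rpow h1.le]
      · congr 1
        push_cast
        field_simp
        ring
      · rw [← sub_eq_add_neg, sub_nonneg, div_le_one h1]
        push_cast
        linarith [(Nat.cast_nonneg n : (0 : ℝ) ≤ n)]
    have h4 : (n : ℝ) ^ r ≤ ((n + 1 : ℕ) : ℝ) ^ r - r * ((n + 1 : ℕ) : ℝ) ^ (r - 1) := by
      rw [h3, Real.rpow_sub_one h1.ne']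
      calc _ ≤ ((n + 1 : ℕ) : ℝ) ^ r * (1 + r * -(1 / ((n + 1 : ℕ) : ℝ))) := by gcongr
        _ = _ := by ring
    calc _ ≤ (n : ℝ) ^ r / r + ((n + 1 : ℕ) : ℝ) ^ (r - 1) := by gcongr
      _ ≤ (((n + 1 : ℕ) : ℝ) ^ r - r * ((n + 1 : ℕ) : ℝ) ^ (r - 1)) / r
          + ((n + 1 : ℕ) : ℝ) ^ (r - 1) := by gcongr
      _ = _ := by field_simp; ring

variable {D E : ℕ → ℝ} {a b c C : ℝ}

theorem le_sumT (hc : 0 < c) (ha1 : a ≤ 1) (hD : ∀ j : ℕ, 1 ≤ j → c * (j : ℝ) ^ a ≤ D j)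
    (hE : ∀ j : ℕ, 1 ≤ j → c * (j : ℝ) ^ b ≤ E j) (hEm : ∀ j : ℕ, 1 ≤ j → E j ≤ E (j + 1))
    {N : ℕ} (hN : 1 ≤ N) : c ^ 2 * (N : ℝ) ^ (a + b - 1) ≤ sumT D E N := by
  have hE1 : 0 ≤ E 1 := le_trans (by positivity) (hE 1 le_rfl)
  have hN0 : (0 : ℝ) < N := by exact_mod_cast hN
  have key : ∀ j ∈ Icc 1 N, c * (N : ℝ) ^ (a - 1) * delta E j ≤ D j / j * delta E j := by
    intro j hj
    rw [mem_Icc] at hj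
    have hj0 : (0 : ℝ) < j := by exact_mod_cast hj.1
    refine mul_le_mul_of_nonneg_right ?_ (delta_nonneg hE1 hEm hj.1)
    have h1 : (N : ℝ) ^ (a - 1) ≤ (j : ℝ) ^ (a - 1) :=
      Real.rpow_le_rpow_of_nonpos hj0 (by exact_mod_cast hj.2) (by linarith)
    calc c * (N : ℝ) ^ (a - 1) ≤ c * (j : ℝ) ^ (a - 1) := by gcongr
      _ = c * (j : ℝ) ^ a / j := by rw [Real.rpow_sub_one hj0.ne']; ring
      _ ≤ D j / j := by gcongr; exact hD j hj.1
  calc c ^ 2 * (N : ℝ) ^ (a + b - 1) = c * (N : ℝ) ^ (a - 1) * (c * (N : ℝ) ^ b) := by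
        rw [show a + b - 1 = (a - 1) + b by ring, Real.rpow_add hN0]; ring
    _ ≤ c * (N : ℝ) ^ (a - 1) * E N := by gcongr; exact hE N hN
    _ = ∑ j ∈ Icc 1 N, c * (N : ℝ) ^ (a - 1) * delta E j := by
        rw [← mul_sum, sum_delta E hN]
    _ ≤ _ := sum_le_sum key

theorem sumT_le (hC : 0 < C) (ha1 : a ≤ 1) (hb1 : b ≤ 1) (hab : 1 < a + b)
    (hD : ∀ j : ℕ, 1 ≤ j → D j ≤ C * (j : ℝ) ^ a) (hE : ∀ j : ℕ, 1 ≤ j → E j ≤ C * (j : ℝ) ^ b)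
    (hE1 : 0 ≤ E 1) (hEm : ∀ j : ℕ, 1 ≤ j → E j ≤ E (j + 1)) {N : ℕ} (hN : 1 ≤ N) :
    sumT D E N ≤ C ^ 2 / (a + b - 1) * (N : ℝ) ^ (a + b - 1) := by
  have abel : ∀ n : ℕ, 1 ≤ n →
      ∑ j ∈ Icc 1 n, (j : ℝ) ^ (a - 1) * delta E j + (n : ℝ) ^ (a - 1) * (C * (n : ℝ) ^ b - E n)
        ≤ C * ∑ j ∈ Icc 1 n, (j : ℝ) ^ (a + b - 1 - 1) := by
    intro n hn
    induction n, hn using Nat.le_induction with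
    | base => simp [delta]
    | succ n hn ih =>
      have h0 : (0 : ℝ) < n := by exact_mod_cast hn
      have h1 : (0 : ℝ) < ((n + 1 : ℕ) : ℝ) := by positivity
      rw [sum_Icc_succ_top (by omega), sum_Icc_succ_top (by omega), mul_add]
      have h2 : ((n + 1 : ℕ) : ℝ) ^ (a - 1) ≤ (n : ℝ) ^ (a - 1) :=
        Real.rpow_le_rpow_of_nonpos h0 (by push_cast; linarith) (by linarith)
      have h3 := rpow_succ_sub_rpow_le hb1 hn
      have h4 : delta E (n + 1) = E (n + 1) - E n := by
        rw [delta, if_neg (by omega)]; simp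
      have h5 : ((n + 1 : ℕ) : ℝ) ^ (a + b - 1 - 1)
          = ((n + 1 : ℕ) : ℝ) ^ (a - 1) * ((n + 1 : ℕ) : ℝ) ^ (b - 1) := by
        rw [← Real.rpow_add h1]; ring_nf
      have h6 : 0 ≤ C * (n : ℝ) ^ b - E n := sub_nonneg.2 (hE n hn)
      have h7 := mul_le_mul_of_nonneg_right h2 h6
      have h8 : 0 < ((n + 1 : ℕ) : ℝ) ^ (a - 1) := by positivity
      have h9 := mul_le_mul_of_nonneg_left h3 (mul_pos hC h8).le
      rw [h4, h5]
      linarith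
  have hr : 0 < a + b - 1 := by linarith
  calc sumT D E N ≤ C * ∑ j ∈ Icc 1 N, (j : ℝ) ^ (a - 1) * delta E j := by
        rw [mul_sum]
        refine sum_le_sum fun j hj => ?_
        rw [mem_Icc] at hj
        have hj0 : (0 : ℝ) < j := by exact_mod_cast hj.1
        rw [← mul_assoc]
        refine mul_le_mul_of_nonneg_right ?_ (delta_nonneg hE1 hEm hj.1)
        rw [Real.rpow_sub_one hj0.ne', ← mul_div_assoc]
        gcongr
        exact hD j hj.1
    _ ≤ C * (C * ((N : ℝ) ^ (a + b - 1) / (a + b - 1))) := by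
        gcongr
        have h1 := abel N hN
        have h2 : 0 ≤ (N : ℝ) ^ (a - 1) * (C * (N : ℝ) ^ b - E N) :=
          mul_nonneg (by positivity) (sub_nonneg.2 (hE N hN))
        have h3 := mul_le_mul_of_nonneg_left (sum_rpow_sub_one_le hr (by linarith) N) hC.le
        linarith
    _ = _ := by ring

theorem approx_minT (hc : 0 < c) (hC : 0 < C) (ha1 : a ≤ 1) (hb1 : b ≤ 1) (hab : 1 < a + b)
    (hD : ∀ j : ℕ, 1 ≤ j → c * (j : ℝ) ^ a ≤ D j ∧ D j ≤ C * (j : ℝ) ^ a)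
    (hE : ∀ j : ℕ, 1 ≤ j → c * (j : ℝ) ^ b ≤ E j ∧ E j ≤ C * (j : ℝ) ^ b)
    (hDm : ∀ j : ℕ, 1 ≤ j → D j ≤ D (j + 1)) (hEm : ∀ j : ℕ, 1 ≤ j → E j ≤ E (j + 1)) :
    Approx (minT D E) (fun N => (N : ℝ) ^ (a + b - 1)) := by
  have hr : 0 < a + b - 1 := by linarith
  refine ⟨c ^ 2, C ^ 2 / (a + b - 1), by positivity, by positivity, fun N hN => ⟨?_, ?_⟩⟩
  · refine le_min ?_ ?_
    · exact le_sumT hc ha1 (fun j hj => (hD j hj).1) (fun j hj => (hE j hj).1) hEm hN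
    · have := le_sumT hc hb1 (fun j hj => (hE j hj).1) (fun j hj => (hD j hj).1) hDm hN
      rwa [add_comm b a] at this
  · refine (min_le_left _ _).trans ?_
    exact sumT_le hC ha1 hb1 hab (fun j hj => (hD j hj).2) (fun j hj => (hE j hj).2)
      (le_trans (by positivity) (hE 1 le_rfl).1) hEm hN

end Sums

end GreedyApprox
namespace GreedyApprox

open Filter Topology

/-! ### Systems with flat polynomials -/

section FlatSystems

variable {ι X : Type*} [NormedAddCommGroup X] [NormedSpace ℂ X]

/-- A biorthogonal system for which `N`-term combinations obey the Nikolskii inequalities of the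
exponentials in `L^p`, `s = 1 - 1/p`, and which has polynomials of Rudin–Shapiro type
(on `I` and on `J`) and of de la Vallée-Poussin type (on `S`, equal to one on `I`). -/
structure FlatSystem (e : ι → X) (f : ι → StrongDual ℂ X) (s C : ℝ) : Prop where
  s_nonneg : 0 ≤ s
  s_le_one : s ≤ 1
  const_pos : 0 < C
  coef_self : ∀ i, f i (e i) = 1
  coef_ne : ∀ i j, i ≠ j → f i (e j) = 0
  norm_le : ∀ (A : Finset ι) (c : ι → ℂ),
    ‖∑ k ∈ A, c k • e k‖ ≤ (A.card : ℝ) ^ max (s - 1 / 2) 0 * √(∑ k ∈ A, ‖c k‖ ^ 2)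
  norm_dual_le : ∀ (A : Finset ι) (c : ι → ℂ),
    ‖∑ k ∈ A, c k • f k‖ ≤ (A.card : ℝ) ^ max (1 / 2 - s) 0 * √(∑ k ∈ A, ‖c k‖ ^ 2)
  exists_flat : ∀ n : ℕ, ∃ (I J S : Finset ι) (ε v : ι → ℂ),
    I.card = 2 ^ n ∧ J.card = 2 ^ n ∧ I ⊆ S ∧ Disjoint S J ∧
    (∀ k, ε k = 1 ∨ ε k = -1) ∧ (∀ k, ‖v k‖ ≤ 1) ∧ (∀ k ∈ I, v k = 1) ∧
    (‖∑ k ∈ I, ε k • e k‖ ≤ C * ((2 : ℝ) ^ n) ^ (1 / 2 : ℝ) ∧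
      ‖∑ k ∈ J, ε k • e k‖ ≤ C * ((2 : ℝ) ^ n) ^ (1 / 2 : ℝ) ∧
      ‖∑ k ∈ S, v k • e k‖ ≤ C * ((2 : ℝ) ^ n) ^ s) ∧
    (‖∑ k ∈ I, ε k • f k‖ ≤ C * ((2 : ℝ) ^ n) ^ (1 / 2 : ℝ) ∧
      ‖∑ k ∈ J, ε k • f k‖ ≤ C * ((2 : ℝ) ^ n) ^ (1 / 2 : ℝ) ∧
      ‖∑ k ∈ S, v k • f k‖ ≤ C * ((2 : ℝ) ^ n) ^ (1 - s))

theorem proj_apply (e : ι → X) (f : ι → StrongDual ℂ X) (A : Finset ι) (x : X) :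
    proj e f A x = ∑ k ∈ A, f k x • e k := by
  simp [proj]

theorem exists_isGreedySet [Infinite ι] (f : ι → StrongDual ℂ X) (x : X)
    (h : Tendsto (fun k => ‖f k x‖) cofinite (𝓝 0)) (N : ℕ) :
    ∃ A : Finset ι, IsGreedySet f x N A := by
  classical
  induction N with
  | zero => exact ⟨∅, rfl, by simp⟩
  | succ N ih =>
    obtain ⟨A, hA, hmax⟩ := ih
    obtain ⟨m, hm, hmm⟩ : ∃ m, m ∉ A ∧ ∀ k ∉ A, ‖f k x‖ ≤ ‖f m x‖ := by
      by_cases hz : ∀ k ∉ A, ‖f k x‖ = 0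
      · obtain ⟨m, hm⟩ := Infinite.exists_notMem_finset A
        exact ⟨m, hm, fun k hk => by rw [hz k hk, hz m hm]⟩
      · push Not at hz
        obtain ⟨k₀, hk₀, hk₀'⟩ := hz
        have hpos : 0 < ‖f k₀ x‖ := lt_of_le_of_ne (norm_nonneg _) (Ne.symm hk₀')
        have hfin : {k | ¬ ‖f k x‖ < ‖f k₀ x‖}.Finite := h.eventually_lt_const hpos
        obtain ⟨m, hm, hmm⟩ := (hfin.toFinset \ A).exists_max_image (fun k => ‖f k x‖)
          ⟨k₀, by simp [hk₀]⟩
        simp only [Finset.mem_sdiff, Set.Finite.mem_toFinset, Set.mem_ofPred_eq, not_lt] at hm hmm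
        refine ⟨m, hm.2, fun k hk => ?_⟩
        by_cases hkk : ‖f k₀ x‖ ≤ ‖f k x‖
        · exact hmm k ⟨hkk, hk⟩
        · exact (not_le.1 hkk).le.trans hm.1
    refine ⟨insert m A, by rw [Finset.card_insert_of_notMem hm, hA], fun n hn k hk => ?_⟩
    rw [Finset.mem_insert, not_or] at hk
    rcases Finset.mem_insert.1 hn with rfl | hn
    · exact hmm k hk.2
    · exact hmax n hn k hk.2

theorem exists_isGreedyOperator [Infinite ι] (e : ι → X) (f : ι → StrongDual ℂ X)
    (h : ∀ x, Tendsto (fun k => ‖f k x‖) cofinite (𝓝 0)) {N : ℕ} {x : X} {B : Finset ι}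
    (hB : IsGreedySet f x N B) :
    ∃ G, IsGreedyOperator e f N G ∧ G x = proj e f B x := by
  classical
  choose A hA using fun y => exists_isGreedySet f y (h y) N
  refine ⟨fun y => if y = x then proj e f B x else proj e f (A y) y, fun y => ?_, by simp⟩
  by_cases hy : y = x
  · subst hy
    exact ⟨B, hB, by simp⟩
  · exact ⟨A y, hA y, by simp [hy]⟩

theorem sigma_bddBelow (e : ι → X) (N : ℕ) (x : X) :
    BddBelow {r : ℝ | ∃ (A : Finset ι) (c : ι → ℂ), A.card ≤ N ∧ r = ‖x - ∑ n ∈ A, c n • e n‖} :=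
  ⟨0, by rintro r ⟨A, c, -, rfl⟩; exact norm_nonneg _⟩

theorem sigmaTilde_le (e : ι → X) (f : ι → StrongDual ℂ X) {N : ℕ} (x : X) {A : Finset ι}
    (hA : A.card ≤ N) : sigmaTilde e f N x ≤ ‖x - proj e f A x‖ :=
  csInf_le ⟨0, by rintro r ⟨A, -, rfl⟩; exact norm_nonneg _⟩ ⟨A, hA, rfl⟩

theorem sigma_le_sigmaTilde (e : ι → X) (f : ι → StrongDual ℂ X) (N : ℕ) (x : X) :
    sigma ℂ e N x ≤ sigmaTilde e f N x := by
  refine le_csInf ⟨_, ∅, by simp, rfl⟩ ?_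
  rintro r ⟨A, hA, rfl⟩
  exact csInf_le (sigma_bddBelow e N x) ⟨A, fun k => f k x, hA, by rw [proj_apply]⟩

theorem sum_le_sum_sdiff [DecidableEq ι] {A B : Finset ι} {g : ι → ℝ} (hg : ∀ k, 0 ≤ g k)
    (hcard : B.card ≤ A.card) (h : ∀ n ∈ A, ∀ m ∉ A, g m ≤ g n) :
    ∑ k ∈ B \ A, g k ≤ ∑ k ∈ A \ B, g k := by
  have hc : (B \ A).card ≤ (A \ B).card := by
    have h1 := Finset.card_sdiff_add_card_inter A B
    have h2 := Finset.card_sdiff_add_card_inter B A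
    rw [Finset.inter_comm] at h2
    omega
  rcases (A \ B).eq_empty_or_nonempty with h0 | h0
  · have : B \ A = ∅ := by rw [← Finset.card_eq_zero]; rw [h0] at hc; simpa using hc
    rw [h0, this]
  · obtain ⟨n, hn, hmin⟩ := (A \ B).exists_min_image g h0
    calc ∑ k ∈ B \ A, g k ≤ (B \ A).card • g n :=
          Finset.sum_le_card_nsmul _ _ _ fun k hk =>
            h n (Finset.mem_sdiff.1 hn).1 k (Finset.mem_sdiff.1 hk).2
      _ ≤ (A \ B).card • g n := nsmul_le_nsmul_left (hg n) hc
      _ ≤ _ := Finset.card_nsmul_le_sum _ _ _ hmin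

namespace FlatSystem

variable {e : ι → X} {f : ι → StrongDual ℂ X} {s C : ℝ}

theorem dual (h : FlatSystem e f s C) {Y : Type*} [NormedAddCommGroup Y] [NormedSpace ℂ Y]
    {g : ι → Y} {φ : ι → StrongDual ℂ Y} (hφ : ∀ i j, φ i (g j) = f j (e i))
    (hg : ∀ (A : Finset ι) (c : ι → ℂ), ‖∑ k ∈ A, c k • g k‖ ≤ ‖∑ k ∈ A, c k • f k‖)
    (hφn : ∀ (A : Finset ι) (c : ι → ℂ), ‖∑ k ∈ A, c k • φ k‖ ≤ ‖∑ k ∈ A, c k • e k‖) :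
    FlatSystem g φ (1 - s) C where
  s_nonneg := by linarith [h.s_le_one]
  s_le_one := by linarith [h.s_nonneg]
  const_pos := h.const_pos
  coef_self i := by rw [hφ, h.coef_self]
  coef_ne i j hij := by rw [hφ, h.coef_ne j i hij.symm]
  norm_le A c := by
    rw [show (1 - s) - 1 / 2 = 1 / 2 - s by ring]
    exact (hg A c).trans (h.norm_dual_le A c)
  norm_dual_le A c := by
    rw [show 1 / 2 - (1 - s) = s - 1 / 2 by ring]
    exact (hφn A c).trans (h.norm_le A c)
  exists_flat n := by
    obtain ⟨I, J, S, ε, v, h1, h2, h3, h4, h5, h6, h7, ⟨e1, e2, e3⟩, ⟨f1, f2, f3⟩⟩ :=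
      h.exists_flat n
    exact ⟨I, J, S, ε, v, h1, h2, h3, h4, h5, h6, h7,
      ⟨(hg _ _).trans f1, (hg _ _).trans f2, (hg _ _).trans f3⟩,
      ⟨(hφn _ _).trans e1, (hφn _ _).trans e2,
        (hφn _ _).trans (by rwa [show 1 - (1 - s) = s by ring])⟩⟩

set_option synthInstance.maxHeartbeats 200000 in
theorem dual_system (h : FlatSystem e f s C) :
    FlatSystem (X := dualSpace f) (dualVec f) (dualCoef e f) (1 - s) C := by
  refine h.dual (fun i j => ?_) (fun A c => ?_) (fun A c => ?_)
  · simp [dualVec, dualCoef]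
  · have : ((∑ k ∈ A, c k • dualVec f k : dualSpace f) : StrongDual ℂ X) = ∑ k ∈ A, c k • f k := by
      simp [dualVec]
    rw [← this]
    exact le_rfl
  · refine ContinuousLinearMap.opNorm_le_bound _ (norm_nonneg _) fun y => ?_
    have : (∑ k ∈ A, c k • dualCoef e f k) y = (y : StrongDual ℂ X) (∑ k ∈ A, c k • e k) := by
      simp [dualCoef, map_sum]
    rw [this, mul_comm]
    exact (y : StrongDual ℂ X).le_opNorm _

theorem bidual_system (h : FlatSystem e f s C) :
    FlatSystem f (fun k => NormedSpace.inclusionInDoubleDual ℂ X (e k)) (1 - s) C := by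
  refine h.dual (fun i j => by simp) (fun A c => le_rfl) (fun A c => ?_)
  refine ContinuousLinearMap.opNorm_le_bound _ (norm_nonneg _) fun y => ?_
  have : (∑ k ∈ A, c k • NormedSpace.inclusionInDoubleDual ℂ X (e k)) y
      = y (∑ k ∈ A, c k • e k) := by
    simp [map_sum]
  rw [this, mul_comm]
  exact y.le_opNorm _

/-- The flat polynomials in terms of `N`, with subsets `I'`, `J'` of cardinality `N`. -/
theorem exists_flat_card (h : FlatSystem e f s C) {N : ℕ} (hN : 1 ≤ N) :
    ∃ (I I' J J' S : Finset ι) (ε v : ι → ℂ),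
    I' ⊆ I ∧ I'.card = N ∧ J' ⊆ J ∧ J'.card = N ∧ I ⊆ S ∧ Disjoint S J ∧
    (∀ k, ε k = 1 ∨ ε k = -1) ∧ (∀ k, ‖v k‖ ≤ 1) ∧ (∀ k ∈ I, v k = 1) ∧
    (‖∑ k ∈ I, ε k • e k‖ ≤ 2 * C * (N : ℝ) ^ (1 / 2 : ℝ) ∧
      ‖∑ k ∈ J, ε k • e k‖ ≤ 2 * C * (N : ℝ) ^ (1 / 2 : ℝ) ∧
      ‖∑ k ∈ S, v k • e k‖ ≤ 2 * C * (N : ℝ) ^ s) ∧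
    (‖∑ k ∈ I, ε k • f k‖ ≤ 2 * C * (N : ℝ) ^ (1 / 2 : ℝ) ∧
      ‖∑ k ∈ J, ε k • f k‖ ≤ 2 * C * (N : ℝ) ^ (1 / 2 : ℝ) ∧
      ‖∑ k ∈ S, v k • f k‖ ≤ 2 * C * (N : ℝ) ^ (1 - s)) := by
  have hle : N ≤ 2 ^ Nat.clog 2 N := Nat.le_pow_clog (by norm_num) N
  have hle2 : 2 ^ Nat.clog 2 N ≤ 2 * N := by
    rcases hN.eq_or_lt with rfl | hN'
    · simp
    · have h1 := Nat.pow_pred_clog_lt_self (b := 2) (by norm_num) hN'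
      have h2 : 0 < Nat.clog 2 N := Nat.clog_pos (by norm_num) hN'
      obtain ⟨m, hm⟩ : ∃ m, Nat.clog 2 N = m + 1 := ⟨Nat.clog 2 N - 1, by omega⟩
      rw [hm] at h1 ⊢
      simp only [Nat.pred_eq_sub_one, Nat.add_sub_cancel] at h1
      rw [pow_succ]
      omega
  obtain ⟨I, J, S, ε, v, h1, h2, h3, h4, h5, h6, h7, ⟨e1, e2, e3⟩, ⟨f1, f2, f3⟩⟩ :=
      h.exists_flat (Nat.clog 2 N)
  have key : ∀ t : ℝ, 0 ≤ t → t ≤ 1 →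
      C * ((2 : ℝ) ^ Nat.clog 2 N) ^ t ≤ 2 * C * (N : ℝ) ^ t := by
    intro t ht ht1
    have hC := h.const_pos
    have a1 : ((2 : ℝ) ^ Nat.clog 2 N) ^ t ≤ (2 * (N : ℝ)) ^ t :=
      Real.rpow_le_rpow (by positivity) (by exact_mod_cast hle2) ht
    rw [Real.mul_rpow (by norm_num) (by positivity)] at a1
    have a2 : (2 : ℝ) ^ t ≤ 2 := by
      simpa using Real.rpow_le_rpow_of_exponent_le (by norm_num : (1 : ℝ) ≤ 2) ht1
    calc C * ((2 : ℝ) ^ Nat.clog 2 N) ^ t ≤ C * (2 * (N : ℝ) ^ t) := by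
          gcongr
          exact a1.trans (by gcongr)
      _ = _ := by ring
  obtain ⟨I', hI', hI'c⟩ := Finset.exists_subset_card_eq (h1.symm ▸ hle : N ≤ I.card)
  obtain ⟨J', hJ', hJ'c⟩ := Finset.exists_subset_card_eq (h2.symm ▸ hle : N ≤ J.card)
  have k1 := key (1 / 2) (by norm_num) (by norm_num)
  have k2 := key s h.s_nonneg h.s_le_one
  have k3 := key (1 - s) (by linarith [h.s_le_one]) (by linarith [h.s_nonneg])
  exact ⟨I, I', J, J', S, ε, v, hI', hI'c, hJ', hJ'c, h3, h4, h5, h6, h7,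
    ⟨e1.trans k1, e2.trans k1, e3.trans k2⟩, ⟨f1.trans k1, f2.trans k1, f3.trans k3⟩⟩

section Basic

variable [DecidableEq ι]

theorem coef_sum (h : FlatSystem e f s C) (T : Finset ι) (a : ι → ℂ) (n : ι) :
    f n (∑ k ∈ T, a k • e k) = if n ∈ T then a n else 0 := by
  rw [map_sum]
  rw [Finset.sum_congr rfl (g := fun k => if n = k then a k else 0) fun k _ => ?_]
  · rw [Finset.sum_ite_eq]
  · rw [map_smul]
    split_ifs with hk
    · rw [hk, h.coef_self, smul_eq_mul, mul_one]
    · rw [h.coef_ne n k hk, smul_zero]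

theorem proj_sum (h : FlatSystem e f s C) (A T : Finset ι) (a : ι → ℂ) :
    proj e f A (∑ k ∈ T, a k • e k) = ∑ k ∈ A ∩ T, a k • e k := by
  rw [proj_apply, ← Finset.sum_ite_mem]
  refine Finset.sum_congr rfl fun k _ => ?_
  rw [h.coef_sum, ite_smul, zero_smul]

theorem sub_proj_sum (h : FlatSystem e f s C) (A T : Finset ι) (a : ι → ℂ) :
    ∑ k ∈ T, a k • e k - proj e f A (∑ k ∈ T, a k • e k) = ∑ k ∈ T \ A, a k • e k := by
  rw [h.proj_sum, sub_eq_iff_eq_add, Finset.inter_comm, add_comm, Finset.sum_inter_add_sum_sdiff]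

theorem card_le_pairing (h : FlatSystem e f s C) {Q T I : Finset ι} {a b : ι → ℂ}
    (hQ : Q ∩ T = I) (hab : ∀ k ∈ I, b k * a k = 1) :
    (I.card : ℝ) ≤ ‖∑ k ∈ Q, b k • f k‖ * ‖∑ k ∈ T, a k • e k‖ := by
  have h1 : (∑ k ∈ Q, b k • f k) (∑ k ∈ T, a k • e k) = I.card := by
    rw [sum_apply, Finset.sum_congr rfl
      (g := fun k => if k ∈ T then b k * a k else 0) fun k _ => ?_]
    · rw [Finset.sum_ite_mem, hQ, Finset.sum_congr rfl hab]
      simp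
    · rw [smul_apply, h.coef_sum, smul_eq_mul, mul_ite, mul_zero]
  have h2 := (∑ k ∈ Q, b k • f k).le_opNorm (∑ k ∈ T, a k • e k)
  rw [h1] at h2
  simpa using h2

end Basic

theorem sqrt_sum_coef_le (h : FlatSystem e f s C) (A : Finset ι) (x : X) :
    √(∑ k ∈ A, ‖f k x‖ ^ 2) ≤ (A.card : ℝ) ^ max (1 / 2 - s) 0 * ‖x‖ := by
  set R := √(∑ k ∈ A, ‖f k x‖ ^ 2) with hR
  have hR2 : R * R = ∑ k ∈ A, ‖f k x‖ ^ 2 :=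
    Real.mul_self_sqrt (Finset.sum_nonneg fun _ _ => by positivity)
  have h1 := h.norm_dual_le A (fun k => (starRingEnd ℂ) (f k x))
  simp only [RCLike.norm_conj, ← hR] at h1
  have h2 : (∑ k ∈ A, (starRingEnd ℂ) (f k x) • f k) x = ((R * R : ℝ) : ℂ) := by
    rw [hR2, sum_apply]
    push_cast
    refine Finset.sum_congr rfl fun k _ => ?_
    change (starRingEnd ℂ) (f k x) * f k x = _
    rw [RCLike.conj_mul]
    simp
  have h3 := (∑ k ∈ A, (starRingEnd ℂ) (f k x) • f k).le_opNorm x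
  rw [h2, Complex.norm_real, Real.norm_of_nonneg (mul_self_nonneg R)] at h3
  have hR0 : 0 ≤ R := Real.sqrt_nonneg _
  rcases hR0.eq_or_lt with h0 | h0
  · rw [← h0]; positivity
  · refine le_of_mul_le_mul_right ?_ h0
    calc R * R ≤ _ := h3
      _ ≤ ((A.card : ℝ) ^ max (1 / 2 - s) 0 * R) * ‖x‖ := by gcongr
      _ = _ := by ring

theorem max_add_max (s : ℝ) : max (s - 1 / 2) 0 + max (1 / 2 - s) 0 = |s - 1 / 2| := by
  rcases le_total s (1 / 2) with h | h
  · rw [max_eq_right (by linarith), max_eq_left (by linarith), abs_of_nonpos (by linarith)]; ring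
  · rw [max_eq_left (by linarith), max_eq_right (by linarith), abs_of_nonneg (by linarith)]; ring

theorem rpow_mul_rpow_le {m N : ℕ} (hm : m ≤ N) (hN : 1 ≤ N) (s : ℝ) :
    (m : ℝ) ^ max (s - 1 / 2) 0 * (N : ℝ) ^ max (1 / 2 - s) 0 ≤ (N : ℝ) ^ |s - 1 / 2| := by
  have hN0 : (0 : ℝ) < N := by exact_mod_cast hN
  rw [← max_add_max, Real.rpow_add hN0]
  gcongr

theorem norm_proj_apply_le (h : FlatSystem e f s C) {A : Finset ι} {N : ℕ} (hA : A.card ≤ N)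
    (hN : 1 ≤ N) (x : X) : ‖proj e f A x‖ ≤ (N : ℝ) ^ |s - 1 / 2| * ‖x‖ := by
  rw [proj_apply]
  calc _ ≤ _ := h.norm_le A _
    _ ≤ (A.card : ℝ) ^ max (s - 1 / 2) 0 * ((A.card : ℝ) ^ max (1 / 2 - s) 0 * ‖x‖) := by
        gcongr
        exact h.sqrt_sum_coef_le A x
    _ ≤ (A.card : ℝ) ^ max (s - 1 / 2) 0 * ((N : ℝ) ^ max (1 / 2 - s) 0 * ‖x‖) := by
        gcongr
    _ = (A.card : ℝ) ^ max (s - 1 / 2) 0 * (N : ℝ) ^ max (1 / 2 - s) 0 * ‖x‖ := by ring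
    _ ≤ _ := by
        gcongr
        exact rpow_mul_rpow_le hA hN s

theorem norm_proj_le (h : FlatSystem e f s C) {A : Finset ι} {N : ℕ} (hA : A.card ≤ N)
    (hN : 1 ≤ N) : ‖proj e f A‖ ≤ (N : ℝ) ^ |s - 1 / 2| :=
  ContinuousLinearMap.opNorm_le_bound _ (by positivity) (h.norm_proj_apply_le hA hN)

theorem condConst_le (h : FlatSystem e f s C) {N : ℕ} (hN : 1 ≤ N) :
    condConst e f N ≤ (N : ℝ) ^ |s - 1 / 2| := by
  refine csSup_le ⟨_, ∅, by simp, rfl⟩ ?_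
  rintro r ⟨A, hA, rfl⟩
  exact h.norm_proj_le hA hN

theorem norm_proj_le_condConst (h : FlatSystem e f s C) {A : Finset ι} {N : ℕ} (hA : A.card ≤ N)
    (hN : 1 ≤ N) : ‖proj e f A‖ ≤ condConst e f N := by
  refine le_csSup ⟨(N : ℝ) ^ |s - 1 / 2|, ?_⟩ ⟨A, hA, rfl⟩
  rintro r ⟨A, hA, rfl⟩
  exact h.norm_proj_le hA hN

/-- Temlyakov's upper bound for the error of greedy approximation. -/
theorem norm_sub_proj_le (h : FlatSystem e f s C) {N : ℕ} (hN : 1 ≤ N) {x : X} {A : Finset ι}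
    (hA : IsGreedySet f x N A) {B : Finset ι} (hB : B.card ≤ N) (c : ι → ℂ) :
    ‖x - proj e f A x‖ ≤ 4 * (N : ℝ) ^ |s - 1 / 2| * ‖x - ∑ k ∈ B, c k • e k‖ := by
  classical
  set t := ∑ k ∈ B, c k • e k with ht
  have hN1 : (1 : ℝ) ≤ N := by exact_mod_cast hN
  have hs : |s - 1 / 2| ≤ 1 := by
    rw [abs_le]
    constructor <;> linarith [h.s_nonneg, h.s_le_one]
  have hcoef : ∀ k ∉ B, f k (x - t) = f k x := fun k hk => by
    rw [map_sub, ht, h.coef_sum, if_neg hk, sub_zero]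
  have hsplit : x - proj e f A x = (x - t) - proj e f (A ∪ B) (x - t) + proj e f (B \ A) x := by
    have h1 : proj e f (A ∪ B) t = t := by
      rw [ht, h.proj_sum, Finset.inter_eq_right.2 Finset.subset_union_right]
    have h2 : proj e f (A ∪ B) x = proj e f A x + proj e f (B \ A) x := by
      rw [proj_apply, proj_apply, proj_apply, ← Finset.union_sdiff_self_eq_union,
        Finset.sum_union Finset.disjoint_sdiff]
    rw [map_sub, h1, h2]
    abel
  have hAB : (A ∪ B).card ≤ 2 * N := by
    have := Finset.card_union_le A B
    have := hA.1
    omega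
  have b1 : ‖proj e f (A ∪ B) (x - t)‖ ≤ 2 * (N : ℝ) ^ |s - 1 / 2| * ‖x - t‖ := by
    refine (h.norm_proj_apply_le hAB (by omega) _).trans ?_
    gcongr
    push_cast
    rw [Real.mul_rpow (by norm_num) (by positivity)]
    gcongr
    simpa using Real.rpow_le_rpow_of_exponent_le (by norm_num : (1 : ℝ) ≤ 2) hs
  have hBA : (B \ A).card ≤ N := (Finset.card_le_card Finset.sdiff_subset).trans hB
  have hAB' : (A \ B).card ≤ N := (Finset.card_le_card Finset.sdiff_subset).trans hA.1.le
  have b2 : ‖proj e f (B \ A) x‖ ≤ (N : ℝ) ^ |s - 1 / 2| * ‖x - t‖ := by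
    rw [proj_apply]
    calc _ ≤ _ := h.norm_le _ _
      _ ≤ ((B \ A).card : ℝ) ^ max (s - 1 / 2) 0 * √(∑ k ∈ A \ B, ‖f k x‖ ^ 2) := by
          gcongr ?_ * √?_
          refine sum_le_sum_sdiff (fun _ => by positivity) (hB.trans hA.1.ge) fun n hn m hm => ?_
          have := hA.2 n hn m hm
          gcongr
      _ = ((B \ A).card : ℝ) ^ max (s - 1 / 2) 0 * √(∑ k ∈ A \ B, ‖f k (x - t)‖ ^ 2) := by
          congr 2
          exact Finset.sum_congr rfl fun k hk => by rw [hcoef k (Finset.mem_sdiff.1 hk).2]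
      _ ≤ ((B \ A).card : ℝ) ^ max (s - 1 / 2) 0 *
            (((A \ B).card : ℝ) ^ max (1 / 2 - s) 0 * ‖x - t‖) := by
          gcongr
          exact h.sqrt_sum_coef_le _ _
      _ ≤ ((B \ A).card : ℝ) ^ max (s - 1 / 2) 0 * ((N : ℝ) ^ max (1 / 2 - s) 0 * ‖x - t‖) := by
          gcongr
      _ = ((B \ A).card : ℝ) ^ max (s - 1 / 2) 0 * (N : ℝ) ^ max (1 / 2 - s) 0 * ‖x - t‖ := by
          ring
      _ ≤ _ := by
          gcongr
          exact rpow_mul_rpow_le hBA hN s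
  have hpow : (1 : ℝ) ≤ (N : ℝ) ^ |s - 1 / 2| := Real.one_le_rpow hN1 (abs_nonneg _)
  have b3 : ‖x - t‖ ≤ (N : ℝ) ^ |s - 1 / 2| * ‖x - t‖ :=
    le_mul_of_one_le_left (norm_nonneg _) hpow
  rw [hsplit]
  have b4 := norm_add_le ((x - t) - proj e f (A ∪ B) (x - t)) (proj e f (B \ A) x)
  have b5 := norm_sub_le (x - t) (proj e f (A ∪ B) (x - t))
  linarith

theorem norm_sub_greedy_le (h : FlatSystem e f s C) {N : ℕ} (hN : 1 ≤ N) {G : X → X}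
    (hG : IsGreedyOperator e f N G) (x : X) :
    ‖x - G x‖ ≤ 4 * (N : ℝ) ^ |s - 1 / 2| * sigma ℂ e N x := by
  obtain ⟨A, hA, hGx⟩ := hG x
  have hpos : (0 : ℝ) < 4 * (N : ℝ) ^ |s - 1 / 2| := by
    have : (0 : ℝ) < N := by exact_mod_cast hN
    positivity
  rw [hGx, ← div_le_iff₀' hpos]
  refine le_csInf ⟨_, ∅, 0, by simp, rfl⟩ ?_
  rintro r ⟨B, c, hB, rfl⟩
  rw [div_le_iff₀' hpos]
  exact h.norm_sub_proj_le hN hA hB c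

theorem lebesgueConst_le (h : FlatSystem e f s C) {N : ℕ} (hN : 1 ≤ N) :
    lebesgueConst e f N ≤ 4 * (N : ℝ) ^ |s - 1 / 2| :=
  csInf_le ⟨0, fun _ hC => hC.1⟩ ⟨by positivity, fun _ hG x => h.norm_sub_greedy_le hN hG x⟩

theorem lebesgueConstTilde_le_lebesgueConst (h : FlatSystem e f s C) {N : ℕ} (hN : 1 ≤ N) :
    lebesgueConstTilde e f N ≤ lebesgueConst e f N := by
  refine csInf_le_csInf ⟨0, fun _ hC => hC.1⟩
    ⟨4 * (N : ℝ) ^ |s - 1 / 2|, by positivity, fun _ hG x => h.norm_sub_greedy_le hN hG x⟩ ?_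
  rintro K ⟨hK, hKG⟩
  exact ⟨hK, fun G hG x => (hKG G hG x).trans
    (mul_le_mul_of_nonneg_left (sigma_le_sigmaTilde e f N x) hK)⟩

end FlatSystem

end FlatSystems

end GreedyApprox
namespace GreedyApprox

open Filter Topology

namespace FlatSystem

variable {ι X : Type*} [NormedAddCommGroup X] [NormedSpace ℂ X]
variable {e : ι → X} {f : ι → StrongDual ℂ X} {s C : ℝ}

theorem le_of_card_le {N : ℕ} (hN : 1 ≤ N) (hC : 0 < C) {t K : ℝ}
    (h : (N : ℝ) ≤ (2 * C * (N : ℝ) ^ t) * (K * (2 * C * (N : ℝ) ^ (1 / 2 : ℝ)))) :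
    1 / (4 * C ^ 2) * (N : ℝ) ^ (1 / 2 - t) ≤ K := by
  have hN0 : (0 : ℝ) < N := by exact_mod_cast hN
  have h1 : (N : ℝ) ^ (1 / 2 - t) * ((N : ℝ) ^ t * (N : ℝ) ^ (1 / 2 : ℝ)) = N := by
    rw [← Real.rpow_add hN0, ← Real.rpow_add hN0]
    ring_nf
    exact Real.rpow_one _
  have h2 : 0 < (N : ℝ) ^ t * (N : ℝ) ^ (1 / 2 : ℝ) := by positivity
  refine le_of_mul_le_mul_right ?_ h2
  have h3 : (0 : ℝ) < 4 * C ^ 2 := by positivity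
  rw [mul_assoc, h1, one_div, inv_mul_le_iff₀ h3]
  linarith

theorem rpow_abs_le {N : ℕ} {c K : ℝ} (h1 : c * (N : ℝ) ^ (1 / 2 - s) ≤ K)
    (h2 : c * (N : ℝ) ^ (1 / 2 - (1 - s)) ≤ K) : c * (N : ℝ) ^ |s - 1 / 2| ≤ K := by
  rcases abs_cases (s - 1 / 2) with ⟨h, -⟩ | ⟨h, -⟩
  · rw [h]; convert h2 using 3; ring
  · rw [h]; convert h1 using 3; ring

section Basic

variable [DecidableEq ι]

theorem isGreedySet_sum (h : FlatSystem e f s C) {T B : Finset ι} {a : ι → ℂ} {N : ℕ} (hBT : B ⊆ T)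
    (hB : B.card = N) (ha : ∀ k ∈ T, ‖a k‖ ≤ 1) (haB : ∀ k ∈ B, ‖a k‖ = 1) :
    IsGreedySet f (∑ k ∈ T, a k • e k) N B := by
  refine ⟨hB, fun n hn m _ => ?_⟩
  rw [h.coef_sum, h.coef_sum, if_pos (hBT hn), haB n hn]
  split_ifs with hm
  · exact ha m hm
  · simp

theorem norm_sdiff_le [Infinite ι] (h : FlatSystem e f s C)
    (h0 : ∀ x, Tendsto (fun k => ‖f k x‖) cofinite (𝓝 0)) {T A B : Finset ι} {a : ι → ℂ} {N : ℕ}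
    (hBT : B ⊆ T) (hB : B.card = N) (ha : ∀ k ∈ T, ‖a k‖ ≤ 1) (haB : ∀ k ∈ B, ‖a k‖ = 1)
    (hA : A.card ≤ N) {K : ℝ} (hK : 0 ≤ K)
    (hG : ∀ G, IsGreedyOperator e f N G → ∀ x, ‖x - G x‖ ≤ K * sigmaTilde e f N x) :
    ‖∑ k ∈ T \ B, a k • e k‖ ≤ K * ‖∑ k ∈ T \ A, a k • e k‖ := by
  obtain ⟨G, hGr, hGx⟩ := exists_isGreedyOperator e f h0 (h.isGreedySet_sum hBT hB ha haB)
  have h1 := hG G hGr (∑ k ∈ T, a k • e k)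
  rw [hGx, h.sub_proj_sum] at h1
  refine h1.trans (mul_le_mul_of_nonneg_left ?_ hK)
  rw [← h.sub_proj_sum]
  exact sigmaTilde_le e f _ hA

theorem norm_sum_sign_le (h : FlatSystem e f s C) {T A : Finset ι} {a ε : ι → ℂ} {N : ℕ}
    (hN : 1 ≤ N) (hA : A.card ≤ N) (hAT : A ⊆ T) (hε : ∀ k, ε k = 1 ∨ ε k = -1) :
    ‖∑ k ∈ A, (ε k * a k) • e k‖ ≤ condConst e f N * (2 * ‖∑ k ∈ T, a k • e k‖) := by
  classical
  have hsplit : ∑ k ∈ A, (ε k * a k) • e k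
      = proj e f (A.filter fun k => ε k = 1) (∑ k ∈ T, a k • e k)
        - proj e f (A.filter fun k => ¬ ε k = 1) (∑ k ∈ T, a k • e k) := by
    rw [h.proj_sum, h.proj_sum,
      Finset.inter_eq_left.2 ((Finset.filter_subset _ _).trans hAT),
      Finset.inter_eq_left.2 ((Finset.filter_subset _ _).trans hAT),
      ← Finset.sum_filter_add_sum_filter_not A (fun k => ε k = 1), sub_eq_add_neg,
      ← Finset.sum_neg_distrib]
    congr 1
    · refine Finset.sum_congr rfl fun k hk => ?_
      rw [(Finset.mem_filter.1 hk).2, one_mul]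
    · refine Finset.sum_congr rfl fun k hk => ?_
      rw [(hε k).resolve_left (Finset.mem_filter.1 hk).2, neg_one_mul, neg_smul]
  have hb : ∀ p : ι → Prop, [DecidablePred p] →
      ‖proj e f (A.filter p) (∑ k ∈ T, a k • e k)‖
        ≤ condConst e f N * ‖∑ k ∈ T, a k • e k‖ := fun p _ =>
    ((proj e f (A.filter p)).le_opNorm _).trans <| by
      gcongr
      exact h.norm_proj_le_condConst ((Finset.card_filter_le _ _).trans hA) hN
  rw [hsplit]
  refine (norm_sub_le _ _).trans ?_
  linarith [hb (fun k => ε k = 1), hb (fun k => ¬ ε k = 1)]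

end Basic

theorem sign_mul_self {ε : ι → ℂ} (hε : ∀ k, ε k = 1 ∨ ε k = -1) (k : ι) : ε k * ε k = 1 := by
  rcases hε k with h | h <;> rw [h] <;> norm_num

theorem norm_sign {ε : ι → ℂ} (hε : ∀ k, ε k = 1 ∨ ε k = -1) (k : ι) : ‖ε k‖ = 1 := by
  rcases hε k with h | h <;> rw [h] <;> norm_num

theorem le_lebesgueConstTilde [Infinite ι] (h : FlatSystem e f s C)
    (h0 : ∀ x, Tendsto (fun k => ‖f k x‖) cofinite (𝓝 0)) {N : ℕ} (hN : 1 ≤ N) :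
    1 / (4 * C ^ 2) * (N : ℝ) ^ |s - 1 / 2| ≤ lebesgueConstTilde e f N := by
  classical
  have hC := h.const_pos
  obtain ⟨I, I', J, J', S, ε, v, hI, hIc, hJ, hJc, hIS, hSJ, hε, hv, hvI, ⟨e1, e2, e3⟩,
    ⟨f1, f2, f3⟩⟩ := h.exists_flat_card hN
  refine le_csInf ⟨4 * (N : ℝ) ^ |s - 1 / 2|, by positivity, fun G hG x =>
    (h.norm_sub_greedy_le hN hG x).trans
      (mul_le_mul_of_nonneg_left (sigma_le_sigmaTilde e f N x) (by positivity))⟩ ?_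
  rintro K ⟨hK, hKG⟩
  have hI'S : I' ⊆ S := hI.trans hIS
  have hSJ' : ∀ k ∈ S, k ∉ J := fun k hk hk' => Finset.disjoint_left.1 hSJ hk hk'
  refine rpow_abs_le (le_of_card_le hN hC ?_) (le_of_card_le hN hC ?_)
  · -- remove `J'` from `S ∪ J'` to get `S`, or greedily remove `I'`
    set a : ι → ℂ := fun k => if k ∈ S then v k else ε k with ha
    have b1 := h.norm_sdiff_le h0 (T := S ∪ J') (A := J') (B := I') (a := a)
      (hI'S.trans Finset.subset_union_left) hIc
      (fun k _ => by
        simp only [ha]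
        split_ifs
        · exact hv k
        · exact (norm_sign hε k).le)
      (fun k hk => by simp only [ha]; rw [if_pos (hI'S hk), hvI k (hI hk), norm_one])
      hJc.le hK hKG
    have hS : (S ∪ J') \ J' = S := by
      rw [Finset.union_sdiff_right, Finset.sdiff_eq_self_iff_disjoint]
      exact hSJ.mono_right hJ
    rw [hS, Finset.sum_congr (s₁ := S) rfl (g := fun k => v k • e k)
      fun k hk => by simp only [ha]; rw [if_pos hk]] at b1
    have b2 := h.card_le_pairing (Q := J) (T := (S ∪ J') \ I') (I := J') (a := a) (b := ε)
      (by
        ext k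
        simp only [Finset.mem_inter, Finset.mem_sdiff, Finset.mem_union]
        constructor
        · rintro ⟨hkJ, hk | hk, -⟩
          · exact absurd hkJ (hSJ' k hk)
          · exact hk
        · intro hk
          exact ⟨hJ hk, Or.inr hk, fun hk' => hSJ' k (hI'S hk') (hJ hk)⟩)
      (fun k hk => by
        simp only [ha]
        rw [if_neg fun hk' => hSJ' k hk' (hJ hk), sign_mul_self hε])
    rw [hJc] at b2
    calc (N : ℝ) ≤ _ := b2
      _ ≤ (2 * C * (N : ℝ) ^ (1 / 2 : ℝ)) * (K * (2 * C * (N : ℝ) ^ s)) := by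
          gcongr
          exact b1.trans (by gcongr)
      _ = _ := by ring
  · -- remove `I'` from `I' ∪ J` to get `J`, or greedily remove `J'`
    set a : ι → ℂ := fun k => if k ∈ S then 1 else ε k with ha
    have b1 := h.norm_sdiff_le h0 (T := I' ∪ J) (A := I') (B := J') (a := a)
      (hJ.trans Finset.subset_union_right) hJc
      (fun k _ => by
        simp only [ha]
        split_ifs
        · exact norm_one.le
        · exact (norm_sign hε k).le)
      (fun k hk => by
        simp only [ha]
        rw [if_neg fun hk' => hSJ' k hk' (hJ hk), norm_sign hε])
      hIc.le hK hKG
    have hS : (I' ∪ J) \ I' = J := by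
      rw [Finset.union_sdiff_left, Finset.sdiff_eq_self_iff_disjoint]
      exact (hSJ.mono_left hI'S).symm
    rw [hS, Finset.sum_congr (s₁ := J) rfl (g := fun k => ε k • e k)
      fun k hk => by simp only [ha]; rw [if_neg fun hk' => hSJ' k hk' hk]] at b1
    have b2 := h.card_le_pairing (Q := S) (T := (I' ∪ J) \ J') (I := I') (a := a) (b := v)
      (by
        ext k
        simp only [Finset.mem_inter, Finset.mem_sdiff, Finset.mem_union]
        constructor
        · rintro ⟨hkS, hk | hk, -⟩
          · exact hk
          · exact absurd hk (hSJ' k hkS)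
        · intro hk
          exact ⟨hI'S hk, Or.inl hk, fun hk' => hSJ' k (hI'S hk) (hJ hk')⟩)
      (fun k hk => by
        simp only [ha]
        rw [if_pos (hI'S hk), hvI k (hI hk), one_mul])
    rw [hIc] at b2
    calc (N : ℝ) ≤ _ := b2
      _ ≤ _ := by
          gcongr
          exact b1.trans (by gcongr)

theorem le_condConst (h : FlatSystem e f s C) {N : ℕ} (hN : 1 ≤ N) :
    1 / (8 * C ^ 2) * (N : ℝ) ^ |s - 1 / 2| ≤ condConst e f N := by
  classical
  have hC := h.const_pos
  obtain ⟨I, I', J, J', S, ε, v, hI, hIc, hJ, hJc, hIS, hSJ, hε, hv, hvI, ⟨e1, e2, e3⟩,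
    ⟨f1, f2, f3⟩⟩ := h.exists_flat_card hN
  have hI'S : I' ⊆ S := hI.trans hIS
  have hK0 : 0 ≤ condConst e f N :=
    (norm_nonneg _).trans (h.norm_proj_le_condConst (A := ∅) (by simp) hN)
  suffices h2 : 1 / (4 * C ^ 2) * (N : ℝ) ^ |s - 1 / 2| ≤ condConst e f N * 2 by
    have : 1 / (8 * C ^ 2) * (N : ℝ) ^ |s - 1 / 2|
        = 1 / (4 * C ^ 2) * (N : ℝ) ^ |s - 1 / 2| / 2 := by ring
    linarith
  refine rpow_abs_le (le_of_card_le hN hC ?_) (le_of_card_le hN hC ?_)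
  · have b1 := h.norm_sum_sign_le (a := v) hN hIc.le hI'S hε
    have b2 := h.card_le_pairing (Q := I) (T := I') (I := I') (a := fun k => ε k * v k) (b := ε)
      (Finset.inter_eq_right.2 hI)
      (fun k hk => by rw [hvI k (hI hk), mul_one, sign_mul_self hε])
    rw [hIc] at b2
    calc (N : ℝ) ≤ _ := b2
      _ ≤ (2 * C * (N : ℝ) ^ (1 / 2 : ℝ)) * (condConst e f N * (2 * (2 * C * (N : ℝ) ^ s))) := by
          gcongr
          exact b1.trans (by gcongr)
      _ = _ := by ring
  · have b1 := h.norm_sum_sign_le (a := ε) hN hIc.le hI hε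
    have b2 := h.card_le_pairing (Q := S) (T := I') (I := I') (a := fun k => ε k * ε k) (b := v)
      (Finset.inter_eq_right.2 hI'S)
      (fun k hk => by rw [hvI k (hI hk), one_mul, sign_mul_self hε])
    rw [hIc] at b2
    calc (N : ℝ) ≤ _ := b2
      _ ≤ (2 * C * (N : ℝ) ^ (1 - s)) *
            (condConst e f N * (2 * (2 * C * (N : ℝ) ^ (1 / 2 : ℝ)))) := by
          gcongr
          exact b1.trans (by gcongr)
      _ = _ := by ring

theorem norm_signed_sum_le (h : FlatSystem e f s C) {A : Finset ι} {ε : ι → ℂ} {N : ℕ}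
    (hN : 1 ≤ N) (hA : A.card = N) (hε : ∀ k, ‖ε k‖ = 1) :
    ‖∑ k ∈ A, ε k • e k‖ ≤ (N : ℝ) ^ max s (1 / 2) := by
  have hN0 : (0 : ℝ) < N := by exact_mod_cast hN
  refine (h.norm_le A ε).trans (le_of_eq ?_)
  simp only [hε, hA, one_pow, Finset.sum_const, nsmul_eq_mul, mul_one]
  rw [Real.sqrt_eq_rpow, ← Real.rpow_add hN0]
  congr 1
  rw [max_add]
  simp

theorem bddAbove_upperDemocracy (h : FlatSystem e f s C) {N : ℕ} (hN : 1 ≤ N) :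
    BddAbove {r : ℝ | ∃ (A : Finset ι) (ε : ι → ℂ), A.card = N ∧ (∀ n, ‖ε n‖ = 1) ∧
      r = ‖∑ n ∈ A, ε n • e n‖} :=
  ⟨(N : ℝ) ^ max s (1 / 2), by rintro r ⟨A, ε, hA, hε, rfl⟩; exact h.norm_signed_sum_le hN hA hε⟩

theorem norm_le_upperDemocracy (h : FlatSystem e f s C) {A : Finset ι} {ε : ι → ℂ} {N : ℕ}
    (hN : 1 ≤ N) (hA : A.card = N) (hε : ∀ k, ‖ε k‖ = 1) :
    ‖∑ k ∈ A, ε k • e k‖ ≤ upperDemocracy ℂ e N :=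
  le_csSup (h.bddAbove_upperDemocracy hN) ⟨A, ε, hA, hε, rfl⟩

theorem upperDemocracy_le [Infinite ι] (h : FlatSystem e f s C) {N : ℕ} (hN : 1 ≤ N) :
    upperDemocracy ℂ e N ≤ (N : ℝ) ^ max s (1 / 2) := by
  obtain ⟨A, -, hA⟩ := (Set.infinite_univ (α := ι)).exists_subset_card_eq N
  refine csSup_le ⟨_, A, 1, hA, by simp, rfl⟩ ?_
  rintro r ⟨A, ε, hA, hε, rfl⟩
  exact h.norm_signed_sum_le hN hA hε

theorem le_upperDemocracy (h : FlatSystem e f s C) {N : ℕ} (hN : 1 ≤ N) :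
    1 / (2 * C) * (N : ℝ) ^ max s (1 / 2) ≤ upperDemocracy ℂ e N := by
  classical
  have hC := h.const_pos
  have hN0 : (0 : ℝ) < N := by exact_mod_cast hN
  obtain ⟨I, I', J, J', S, ε, v, hI, hIc, hJ, hJc, hIS, hSJ, hε, hv, hvI, ⟨e1, e2, e3⟩,
    ⟨f1, f2, f3⟩⟩ := h.exists_flat_card hN
  have key : ∀ t : ℝ, (N : ℝ) ≤ 2 * C * (N : ℝ) ^ (1 - t) * upperDemocracy ℂ e N →
      1 / (2 * C) * (N : ℝ) ^ t ≤ upperDemocracy ℂ e N := by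
    intro t ht
    have h1 : (N : ℝ) ^ t * (N : ℝ) ^ (1 - t) = N := by
      rw [← Real.rpow_add hN0]; simp
    refine le_of_mul_le_mul_right ?_ (show 0 < (N : ℝ) ^ (1 - t) by positivity)
    rw [mul_assoc, h1, one_div, inv_mul_le_iff₀ (by positivity)]
    linarith
  rcases max_cases s (1 / 2) with ⟨hm, -⟩ | ⟨hm, -⟩
  · rw [hm]
    refine key s ?_
    have b1 := h.norm_le_upperDemocracy (ε := 1) hN hIc (by simp)
    have b2 := h.card_le_pairing (Q := S) (T := I') (I := I') (a := 1) (b := v)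
      (Finset.inter_eq_right.2 (hI.trans hIS))
      (fun k hk => by rw [hvI k (hI hk), one_mul, Pi.one_apply])
    rw [hIc] at b2
    exact b2.trans (by gcongr)
  · rw [hm]
    refine key (1 / 2) ?_
    have b1 := h.norm_le_upperDemocracy hN hIc (norm_sign hε)
    have b2 := h.card_le_pairing (Q := I) (T := I') (I := I') (a := ε) (b := ε)
      (Finset.inter_eq_right.2 hI) (fun k _ => sign_mul_self hε k)
    rw [hIc] at b2
    refine b2.trans ?_
    rw [show (1 : ℝ) - 1 / 2 = 1 / 2 by norm_num]
    gcongr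

theorem upperDemocracy_mono [Infinite ι] (h : FlatSystem e f s C) {N : ℕ} (hN : 1 ≤ N) :
    upperDemocracy ℂ e N ≤ upperDemocracy ℂ e (N + 1) := by
  classical
  obtain ⟨A, -, hA⟩ := (Set.infinite_univ (α := ι)).exists_subset_card_eq N
  refine csSup_le ⟨_, A, 1, hA, by simp, rfl⟩ ?_
  rintro r ⟨A, ε, hA, hε, rfl⟩
  obtain ⟨m, hm⟩ := Infinite.exists_notMem_finset A
  have key : ∀ δ : ℂ, ‖δ‖ = 1 →
      ‖∑ k ∈ A, ε k • e k + δ • e m‖ ≤ upperDemocracy ℂ e (N + 1) := by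
    intro δ hδ
    have h1 := h.norm_le_upperDemocracy (A := insert m A) (ε := Function.update ε m δ)
      (N := N + 1) (by omega) (by rw [Finset.card_insert_of_notMem hm, hA])
      (fun k => by
        by_cases hk : k = m
        · subst hk; simpa using hδ
        · simpa [hk] using hε k)
    rw [Finset.sum_insert hm, Function.update_self, add_comm] at h1
    rwa [Finset.sum_congr rfl (g := fun k => ε k • e k) fun k hk => by
      rw [Function.update_of_ne (ne_of_mem_of_not_mem hk hm)]] at h1
  have h1 := key 1 (by simp)
  have h2 := key (-1) (by simp)
  have h3 : (2 : ℝ) * ‖∑ k ∈ A, ε k • e k‖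
      ≤ ‖∑ k ∈ A, ε k • e k + (1 : ℂ) • e m‖ + ‖∑ k ∈ A, ε k • e k + (-1 : ℂ) • e m‖ := by
    refine le_trans (le_of_eq ?_) (norm_add_le _ _)
    rw [show ∑ k ∈ A, ε k • e k + (1 : ℂ) • e m + (∑ k ∈ A, ε k • e k + (-1 : ℂ) • e m)
      = (2 : ℂ) • ∑ k ∈ A, ε k • e k by rw [two_smul, neg_one_smul, one_smul]; abel, norm_smul]
    simp
  linarith

theorem approx_upperDemocracy [Infinite ι] (h : FlatSystem e f s C) (hs : s ≠ 1 / 2) :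
    Approx (minT (upperDemocracy ℂ e) (upperDemocracy ℂ f)) (fun N => (N : ℝ) ^ |s - 1 / 2|) := by
  have hd := h.bidual_system
  have hC := h.const_pos
  have hsum : max s (1 / 2) + max (1 - s) (1 / 2) - 1 = |s - 1 / 2| := by
    rcases le_total s (1 / 2) with h | h
    · rw [max_eq_right h, max_eq_left (by linarith), abs_of_nonpos (by linarith)]; ring
    · rw [max_eq_left h, max_eq_right (by linarith), abs_of_nonneg (by linarith)]; ring
  have hpos : 0 < |s - 1 / 2| := abs_pos.2 (sub_ne_zero.2 hs)
  rw [← hsum]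
  refine approx_minT (c := 1 / (2 * C)) (C := 1) (by positivity) one_pos
    (max_le h.s_le_one (by norm_num)) (max_le hd.s_le_one (by norm_num)) (by linarith)
    (fun j hj => ⟨h.le_upperDemocracy hj, ?_⟩) (fun j hj => ⟨hd.le_upperDemocracy hj, ?_⟩)
    (fun j hj => h.upperDemocracy_mono hj) (fun j hj => hd.upperDemocracy_mono hj)
  · rw [one_mul]; exact h.upperDemocracy_le hj
  · rw [one_mul]; exact hd.upperDemocracy_le hj

theorem approx_condConst (h : FlatSystem e f s C) :
    Approx (condConst e f) (fun N => (N : ℝ) ^ |s - 1 / 2|) := by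
  have hC := h.const_pos
  refine ⟨1 / (8 * C ^ 2), 1, by positivity, one_pos, fun N hN => ⟨h.le_condConst hN, ?_⟩⟩
  rw [one_mul]
  exact h.condConst_le hN

theorem approx_lebesgueConst [Infinite ι] (h : FlatSystem e f s C)
    (h0 : ∀ x, Tendsto (fun k => ‖f k x‖) cofinite (𝓝 0)) :
    Approx (lebesgueConst e f) (fun N => (N : ℝ) ^ |s - 1 / 2|) := by
  have hC := h.const_pos
  exact ⟨1 / (4 * C ^ 2), 4, by positivity, by norm_num, fun N hN =>
    ⟨(h.le_lebesgueConstTilde h0 hN).trans (h.lebesgueConstTilde_le_lebesgueConst hN),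
      h.lebesgueConst_le hN⟩⟩

theorem approx_lebesgueConstTilde [Infinite ι] (h : FlatSystem e f s C)
    (h0 : ∀ x, Tendsto (fun k => ‖f k x‖) cofinite (𝓝 0)) :
    Approx (lebesgueConstTilde e f) (fun N => (N : ℝ) ^ |s - 1 / 2|) := by
  have hC := h.const_pos
  exact ⟨1 / (4 * C ^ 2), 4, by positivity, by norm_num, fun N hN =>
    ⟨h.le_lebesgueConstTilde h0 hN,
      (h.lebesgueConstTilde_le_lebesgueConst hN).trans (h.lebesgueConst_le hN)⟩⟩

end FlatSystem

/-- Coefficients tend to zero when the vectors span a dense subspace. -/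
theorem tendsto_coef_of_dense {ι X : Type*} [NormedAddCommGroup X] [NormedSpace ℂ X]
    {e : ι → X} {f : ι → StrongDual ℂ X} (hne : ∀ i j, i ≠ j → f i (e j) = 0)
    (hf : ∀ i, ‖f i‖ ≤ 1) (hd : (Submodule.span ℂ (Set.range e)).topologicalClosure = ⊤) (x : X) :
    Tendsto (fun k => ‖f k x‖) cofinite (𝓝 0) := by
  have hspan : ∀ y ∈ Submodule.span ℂ (Set.range e), Set.Finite {k | f k y ≠ 0} := by
    intro y hy
    induction hy using Submodule.span_induction with
    | mem y hy =>
      obtain ⟨j, rfl⟩ := hy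
      refine (Set.finite_singleton j).subset fun k hk => ?_
      by_contra hkj
      exact hk (hne k j hkj)
    | zero => simp
    | add y z _ _ hy hz =>
      refine (hy.union hz).subset fun k hk => ?_
      by_contra hkk
      simp only [Set.mem_union, Set.mem_ofPred_eq, not_or, not_not] at hkk hk
      exact hk (by rw [map_add, hkk.1, hkk.2, add_zero])
    | smul c y _ hy =>
      refine hy.subset fun k hk hk' => hk (by rw [map_smul, hk', smul_zero])
  rw [Metric.tendsto_nhds]
  intro δ hδ
  have hx : x ∈ closure (Submodule.span ℂ (Set.range e) : Set X) := by
    have : x ∈ (Submodule.span ℂ (Set.range e)).topologicalClosure := hd ▸ Submodule.mem_top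
    exact this
  obtain ⟨y, hy, hxy⟩ := Metric.mem_closure_iff.1 hx δ hδ
  refine (hspan y hy).subset fun k hk hk' => hk ?_
  have h1 : ‖f k x‖ < δ := by
    calc ‖f k x‖ = ‖f k (x - y)‖ := by rw [map_sub, hk', sub_zero]
      _ ≤ 1 * ‖x - y‖ := (f k).le_of_opNorm_le (hf k) _
      _ < δ := by rwa [one_mul, ← dist_eq_norm]
  simpa using h1

section Dual

variable {ι X : Type*} [NormedAddCommGroup X] [NormedSpace ℂ X]
  {e : ι → X} {f : ι → StrongDual ℂ X}

set_option synthInstance.maxHeartbeats 200000 in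
theorem tendsto_dualCoef (hne : ∀ i j, i ≠ j → f i (e j) = 0) (he : ∀ i, ‖e i‖ ≤ 1)
    (y : dualSpace f) : Tendsto (fun k => ‖dualCoef e f k y‖) cofinite (𝓝 0) := by
  refine tendsto_coef_of_dense (e := dualVec f) (fun i j hij => ?_) (fun i => ?_) ?_ y
  · simpa [dualVec, dualCoef] using hne j i hij.symm
  · refine ContinuousLinearMap.opNorm_le_bound _ zero_le_one fun y => ?_
    rw [mul_comm]
    exact (y : StrongDual ℂ X).le_opNorm_of_le (he i)
  · rw [Submodule.eq_top_iff']
    intro z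
    have hz : (z : StrongDual ℂ X) ∈ closure (Submodule.span ℂ (Set.range f) : Set _) := z.2
    change z ∈ closure (Submodule.span ℂ (Set.range (dualVec f)) : Set (dualSpace f))
    rw [closure_subtype]
    convert hz using 2
    have : f = fun i => (dualSpace f).subtype (dualVec f i) := rfl
    conv_rhs => rw [this]
    rw [show (Set.range fun i => (dualSpace f).subtype (dualVec f i))
      = (dualSpace f).subtype '' Set.range (dualVec f) from (Set.range_comp _ _),
      Submodule.span_image]
    rfl

/-- All the equivalences for a flat system with bounded vectors and a dense span. -/
theorem FlatSystem.approx_all [Infinite ι] {s C : ℝ} (h : FlatSystem e f s C) (hs : s ≠ 1 / 2)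
    (he : ∀ i, ‖e i‖ ≤ 1) (hf : ∀ i, ‖f i‖ ≤ 1)
    (hd : (Submodule.span ℂ (Set.range e)).topologicalClosure = ⊤) {t : ℝ} (ht : t = |s - 1 / 2|) :
    Approx (minT (upperDemocracy ℂ e) (upperDemocracy ℂ f)) (fun N => (N : ℝ) ^ t) ∧
    Approx (lebesgueConst e f) (fun N => (N : ℝ) ^ t) ∧
    Approx (lebesgueConstTilde e f) (fun N => (N : ℝ) ^ t) ∧
    Approx (condConst e f) (fun N => (N : ℝ) ^ t) ∧
    Approx (dualLebesgueConst e f) (fun N => (N : ℝ) ^ t) ∧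
    Approx (dualLebesgueConstTilde e f) (fun N => (N : ℝ) ^ t) := by
  have h0 := tendsto_coef_of_dense h.coef_ne hf hd
  have h0d := tendsto_dualCoef h.coef_ne he
  have hdual := h.dual_system
  have ht' : t = |(1 - s) - 1 / 2| := by
    rw [ht, ← abs_neg]; congr 1; ring
  refine ⟨ht ▸ h.approx_upperDemocracy hs, ht ▸ h.approx_lebesgueConst h0,
    ht ▸ h.approx_lebesgueConstTilde h0, ht ▸ h.approx_condConst, ?_, ?_⟩
  · rw [ht']; exact hdual.approx_lebesgueConst h0d
  · rw [ht']; exact hdual.approx_lebesgueConstTilde h0d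

end Dual

end GreedyApprox
namespace GreedyApprox

open MeasureTheory ENNReal

/-! ### Trigonometric polynomials -/

section Interpolation

variable {α F : Type*} {m : MeasurableSpace α} {μ : Measure α} [NormedAddCommGroup F]

/-- Interpolation between `L^r` and `L^∞`. -/
theorem eLpNorm_le_eLpNorm_rpow_mul {r q : ℝ≥0∞} (hr : 1 ≤ r) (hr' : r ≠ ∞) (hrq : r ≤ q)
    {h : α → F} {b : ℝ≥0∞} (hb' : b ≠ ∞) (hb : ∀ x, ‖h x‖ₑ ≤ b) :
    eLpNorm h q μ ≤ eLpNorm h r μ ^ (r.toReal / q.toReal) * b ^ (1 - r.toReal / q.toReal) := by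
  have hr0 : r ≠ 0 := (zero_lt_one.trans_le hr).ne'
  have hrpos : 0 < r.toReal := ENNReal.toReal_pos hr0 hr'
  rcases eq_or_ne q ∞ with rfl | hq
  · simpa using eLpNormEssSup_le_of_ae_enorm_bound (Filter.Eventually.of_forall hb)
  · have hq0 : q ≠ 0 := (zero_lt_one.trans_le (hr.trans hrq)).ne'
    have hqpos : 0 < q.toReal := ENNReal.toReal_pos hq0 hq
    have hle : r.toReal ≤ q.toReal := (ENNReal.toReal_le_toReal hr' hq).2 hrq
    have hpt : ∀ x, ‖h x‖ₑ ^ q.toReal ≤ b ^ (q.toReal - r.toReal) * ‖h x‖ₑ ^ r.toReal := by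
      intro x
      calc ‖h x‖ₑ ^ q.toReal = ‖h x‖ₑ ^ ((q.toReal - r.toReal) + r.toReal) := by ring_nf
        _ = ‖h x‖ₑ ^ (q.toReal - r.toReal) * ‖h x‖ₑ ^ r.toReal :=
            ENNReal.rpow_add_of_nonneg _ _ (by linarith) hrpos.le
        _ ≤ _ := by gcongr; exact hb x
    have hbt : b ^ (q.toReal - r.toReal) ≠ ∞ := ENNReal.rpow_ne_top_of_nonneg (by linarith) hb'
    rw [eLpNorm_eq_lintegral_rpow_enorm_toReal hq0 hq, eLpNorm_eq_lintegral_rpow_enorm_toReal hr0 hr']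
    calc (∫⁻ x, ‖h x‖ₑ ^ q.toReal ∂μ) ^ (1 / q.toReal)
        ≤ (∫⁻ x, b ^ (q.toReal - r.toReal) * ‖h x‖ₑ ^ r.toReal ∂μ) ^ (1 / q.toReal) := by
          gcongr with x
          exact hpt x
      _ = (b ^ (q.toReal - r.toReal) * ∫⁻ x, ‖h x‖ₑ ^ r.toReal ∂μ) ^ (1 / q.toReal) := by
          rw [lintegral_const_mul' _ _ hbt]
      _ = _ := by
          rw [ENNReal.mul_rpow_of_nonneg _ _ (by positivity), ← ENNReal.rpow_mul,
            ← ENNReal.rpow_mul, mul_comm]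
          congr 2 <;> field_simp

end Interpolation

section Torus

variable {d : ℕ}

/-- The trigonometric polynomial with spectrum in `A` and coefficients `c`. -/
noncomputable def trigPoly (A : Finset (Fin d → ℤ)) (c : (Fin d → ℤ) → ℂ) : TorusC d :=
  ∑ k ∈ A, c k • UnitAddTorus.mFourier k

/-- The norm of `L^q` of the torus as a real number. -/
noncomputable def torusNorm (q : ℝ≥0∞) (h : TorusC d) : ℝ :=
  (eLpNorm h q (torusMeasure d)).toReal

theorem eLpNorm_torus_ne_top (q : ℝ≥0∞) (h : TorusC d) : eLpNorm h q (torusMeasure d) ≠ ∞ := by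
  have : MemLp h q (torusMeasure d) :=
    MemLp.of_bound h.continuous.aestronglyMeasurable ‖h‖
      (Filter.Eventually.of_forall fun t => h.norm_coe_le_norm t)
  exact this.eLpNorm_ne_top

theorem torusNorm_nonneg (q : ℝ≥0∞) (h : TorusC d) : 0 ≤ torusNorm q h := ENNReal.toReal_nonneg

theorem torusNorm_mono {q r : ℝ≥0∞} (hqr : q ≤ r) (h : TorusC d) : torusNorm q h ≤ torusNorm r h :=
  ENNReal.toReal_mono (eLpNorm_torus_ne_top r h)
    (eLpNorm_le_eLpNorm_of_exponent_le hqr h.continuous.aestronglyMeasurable)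

theorem torusNorm_le_of_bound (q : ℝ≥0∞) {h : TorusC d} {b : ℝ} (hb : ∀ t, ‖h t‖ ≤ b) :
    torusNorm q h ≤ b := by
  have hb0 : 0 ≤ b := (norm_nonneg _).trans (hb 0)
  refine (torusNorm_mono le_top h).trans ?_
  refine ENNReal.toReal_le_of_le_ofReal hb0 ?_
  rw [eLpNorm_exponent_top]
  refine eLpNormEssSup_le_of_ae_enorm_bound (Filter.Eventually.of_forall fun t => ?_)
  rw [← ofReal_norm]
  exact ENNReal.ofReal_le_ofReal (hb t)

theorem torusNorm_le_rpow_mul {r q : ℝ≥0∞} (hr : 1 ≤ r) (hr' : r ≠ ∞) (hrq : r ≤ q) {h : TorusC d}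
    {b : ℝ} (hb : ∀ t, ‖h t‖ ≤ b) :
    torusNorm q h ≤ torusNorm r h ^ (r.toReal / q.toReal) * b ^ (1 - r.toReal / q.toReal) := by
  have hb0 : 0 ≤ b := (norm_nonneg _).trans (hb 0)
  have hle : r.toReal / q.toReal ≤ 1 := by
    rcases eq_or_ne q ∞ with rfl | hq
    · simp
    · exact div_le_one_of_le₀ ((ENNReal.toReal_le_toReal hr' hq).2 hrq) ENNReal.toReal_nonneg
  have h1 := eLpNorm_le_eLpNorm_rpow_mul (μ := torusMeasure d) hr hr' hrq (h := h)
    (b := ENNReal.ofReal b) ENNReal.ofReal_ne_top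
    (fun t => by rw [← ofReal_norm]; exact ENNReal.ofReal_le_ofReal (hb t))
  have h2 := ENNReal.toReal_mono (ENNReal.mul_ne_top
    (ENNReal.rpow_ne_top_of_nonneg (by positivity) (eLpNorm_torus_ne_top r h))
    (ENNReal.rpow_ne_top_of_nonneg (by linarith) ENNReal.ofReal_ne_top)) h1
  rwa [ENNReal.toReal_mul, ← ENNReal.toReal_rpow, ← ENNReal.toReal_rpow,
    ENNReal.toReal_ofReal hb0] at h2

theorem orthonormal_trigLp : Orthonormal ℂ (trigLp d 2) := UnitAddTorus.orthonormal_mFourier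

theorem integral_mFourier_neg_mul (k j : Fin d → ℤ) :
    ∫ t, UnitAddTorus.mFourier (-k) t * UnitAddTorus.mFourier j t ∂(torusMeasure d)
      = if k = j then 1 else 0 := by
  rw [← orthonormal_iff_ite.1 (orthonormal_trigLp (d := d)) k j, trigLp, trigLp,
    ContinuousMap.inner_toLp]
  refine integral_congr_ae (Filter.Eventually.of_forall fun t => ?_)
  simp only [UnitAddTorus.mFourier_neg]
  exact mul_comm _ _

theorem sum_trigLp (p : ℝ≥0∞) [Fact (1 ≤ p)] (A : Finset (Fin d → ℤ)) (c : (Fin d → ℤ) → ℂ) :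
    ∑ k ∈ A, c k • trigLp d p k = ContinuousMap.toLp p (torusMeasure d) ℂ (trigPoly A c) := by
  simp [trigPoly, trigLp, map_sum]

theorem norm_toLp_eq (p : ℝ≥0∞) [Fact (1 ≤ p)] (h : TorusC d) :
    ‖ContinuousMap.toLp p (torusMeasure d) ℂ h‖ = torusNorm p h := by
  rw [Lp.norm_def, torusNorm, eLpNorm_congr_ae (ContinuousMap.coeFn_toLp _ _)]

theorem torusNorm_two (A : Finset (Fin d → ℤ)) (c : (Fin d → ℤ) → ℂ) :
    torusNorm 2 (trigPoly A c) = √(∑ k ∈ A, ‖c k‖ ^ 2) := by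
  rw [← norm_toLp_eq, ← sum_trigLp, ← Real.sqrt_sq (norm_nonneg (∑ k ∈ A, c k • trigLp d 2 k))]
  congr 1
  rw [← inner_self_eq_norm_sq (𝕜 := ℂ), orthonormal_trigLp.inner_sum]
  simp only [RCLike.conj_mul, map_sum]
  refine Finset.sum_congr rfl fun k _ => ?_
  norm_cast

theorem trigPoly_apply (A : Finset (Fin d → ℤ)) (c : (Fin d → ℤ) → ℂ) (t : UnitAddTorus (Fin d)) :
    trigPoly A c t = ∑ k ∈ A, c k * UnitAddTorus.mFourier k t := by
  simp [trigPoly]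

theorem norm_trigPoly_apply_le (A : Finset (Fin d → ℤ)) (c : (Fin d → ℤ) → ℂ)
    (t : UnitAddTorus (Fin d)) :
    ‖trigPoly A c t‖ ≤ √A.card * √(∑ k ∈ A, ‖c k‖ ^ 2) := by
  rw [trigPoly_apply]
  refine (norm_sum_le _ _).trans ?_
  simp only [norm_mul, norm_mFourier_apply]
  refine (Real.sum_mul_le_sqrt_mul_sqrt A (fun k => ‖c k‖) (fun _ => 1)).trans (le_of_eq ?_)
  simp [mul_comm]

/-- The Nikolskii inequality for polynomials with `|A|` terms. -/
theorem torusNorm_trigPoly_le (q : ℝ≥0∞) (hq : 1 ≤ q) (A : Finset (Fin d → ℤ))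
    (c : (Fin d → ℤ) → ℂ) :
    torusNorm q (trigPoly A c)
      ≤ (A.card : ℝ) ^ max (1 / 2 - 1 / q.toReal) 0 * √(∑ k ∈ A, ‖c k‖ ^ 2) := by
  set R := √(∑ k ∈ A, ‖c k‖ ^ 2) with hR
  have hR0 : 0 ≤ R := Real.sqrt_nonneg _
  rcases le_total q 2 with h2 | h2
  · have hqt : q ≠ ∞ := (h2.trans_lt (by simp)).ne
    have hq0 : 0 < q.toReal := ENNReal.toReal_pos (zero_lt_one.trans_le hq).ne' hqt
    have : q.toReal ≤ 2 := by simpa using (ENNReal.toReal_le_toReal hqt (by simp)).2 h2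
    have h3 : 1 / 2 ≤ 1 / q.toReal := one_div_le_one_div_of_le hq0 this
    rw [max_eq_right (by linarith), Real.rpow_zero, one_mul, hR, ← torusNorm_two]
    exact torusNorm_mono h2 _
  · have h1 := torusNorm_le_rpow_mul (by norm_num) (by simp) h2 (norm_trigPoly_apply_le A c)
    rw [torusNorm_two, ← hR] at h1
    have h3 : 1 / q.toReal ≤ 1 / 2 := by
      rcases eq_or_ne q ∞ with rfl | hqt
      · simp
      · refine one_div_le_one_div_of_le (by norm_num) ?_
        simpa using (ENNReal.toReal_le_toReal (by simp) hqt).2 h2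
    rw [max_eq_left (by linarith)]
    refine h1.trans (le_of_eq ?_)
    rw [ENNReal.toReal_ofNat, show (2 : ℝ) / q.toReal = 2 * (1 / q.toReal) by ring,
      Real.mul_rpow (Real.sqrt_nonneg _) hR0, Real.sqrt_eq_rpow, ← Real.rpow_mul (Nat.cast_nonneg _)]
    rcases hR0.eq_or_lt with h0 | h0
    · rw [← h0]
      rcases eq_or_ne (1 / q.toReal) (1 / 2) with h4 | h4
      · rw [h4]; norm_num
      · rw [Real.zero_rpow (x := 1 - 2 * (1 / q.toReal))
          (by intro h5; exact h4 (by linarith))]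
        ring
    · have h5 : R ^ (2 * (1 / q.toReal)) * R ^ (1 - 2 * (1 / q.toReal)) = R := by
        rw [← Real.rpow_add h0]; simp
      rw [mul_left_comm, h5]
      congr 2
      ring

theorem norm_integral_conj_mul_le {p q : ℝ≥0∞} [HolderConjugate q p] (h : TorusC d)
    {g : UnitAddTorus (Fin d) → ℂ} (hg : MemLp g p (torusMeasure d)) :
    ‖∫ t, (starRingEnd ℂ) (h t) * g t ∂(torusMeasure d)‖
      ≤ torusNorm q h * (eLpNorm g p (torusMeasure d)).toReal := by
  have hh : AEStronglyMeasurable (fun t => (starRingEnd ℂ) (h t)) (torusMeasure d) :=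
    (RCLike.continuous_conj.comp h.continuous).aestronglyMeasurable
  have h1 := eLpNorm_smul_le_mul_eLpNorm (p := q) (q := p) (r := 1) hg.aestronglyMeasurable hh
  have h2 : eLpNorm (fun t => (starRingEnd ℂ) (h t)) q (torusMeasure d)
      = eLpNorm h q (torusMeasure d) :=
    eLpNorm_congr_norm_ae (Filter.Eventually.of_forall fun t => RCLike.norm_conj _)
  rw [h2] at h1
  have h3 := ENNReal.toReal_mono
    (ENNReal.mul_ne_top (eLpNorm_torus_ne_top q h) hg.eLpNorm_ne_top) h1
  rw [ENNReal.toReal_mul] at h3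
  refine le_trans ?_ h3
  refine (norm_integral_le_integral_norm _).trans (le_of_eq ?_)
  rw [eLpNorm_one_eq_lintegral_enorm]
  exact integral_norm_eq_lintegral_enorm (hh.mul hg.aestronglyMeasurable)

end Torus

end GreedyApprox
namespace GreedyApprox

open MeasureTheory ENNReal

/-! ### Flat trigonometric polynomials -/

section Flat

open Finset

/-- The Rudin–Shapiro polynomials. -/
theorem exists_rudinShapiro (n : ℕ) : ∃ a b : ℕ → ℂ,
    (∀ k, a k = 1 ∨ a k = -1) ∧ (∀ k, b k = 1 ∨ b k = -1) ∧ ∀ z : ℂ, ‖z‖ = 1 →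
      ‖∑ k ∈ range (2 ^ n), a k * z ^ k‖ ^ 2 + ‖∑ k ∈ range (2 ^ n), b k * z ^ k‖ ^ 2
        = 2 ^ (n + 1) := by
  induction n with
  | zero => exact ⟨1, 1, by simp, by simp, fun z _ => by norm_num⟩
  | succ n ih =>
    obtain ⟨a, b, ha, hb, hab⟩ := ih
    have hsum : ∀ (c : ℕ → ℂ) (z : ℂ),
        ∑ k ∈ range (2 ^ (n + 1)), (if k < 2 ^ n then a k else c (k - 2 ^ n)) * z ^ k
          = ∑ k ∈ range (2 ^ n), a k * z ^ k + z ^ 2 ^ n * ∑ k ∈ range (2 ^ n), c k * z ^ k := by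
      intro c z
      rw [pow_succ, mul_two, sum_range_add, mul_sum]
      congr 1
      · exact sum_congr rfl fun k hk => by rw [if_pos (mem_range.1 hk)]
      · refine sum_congr rfl fun k _ => ?_
        rw [if_neg (by omega), Nat.add_sub_cancel_left, pow_add]
        ring
    refine ⟨fun k => if k < 2 ^ n then a k else b (k - 2 ^ n),
      fun k => if k < 2 ^ n then a k else (-b) (k - 2 ^ n), fun k => ?_, fun k => ?_,
      fun z hz => ?_⟩
    · dsimp only
      split_ifs
      · exact ha k
      · exact hb _
    · dsimp only
      split_ifs
      · exact ha k
      · rw [Pi.neg_apply, neg_inj, neg_eq_iff_eq_neg]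
        exact (hb _).symm
    · rw [hsum, hsum]
      have h1 := parallelogram_law_with_norm ℂ (∑ k ∈ range (2 ^ n), a k * z ^ k)
        (z ^ 2 ^ n * ∑ k ∈ range (2 ^ n), b k * z ^ k)
      have h2 := hab z hz
      rw [norm_mul, norm_pow, hz, one_pow, one_mul] at h1
      simp only [Pi.neg_apply, neg_mul, sum_neg_distrib, mul_neg, ← sub_eq_add_neg]
      rw [pow_succ (2 : ℝ) (n + 1), ← h2]
      linarith

/-- The exponents along one coordinate axis. -/
def axis {d : ℕ} (i : Fin d) : ℕ ↪ (Fin d → ℤ) where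
  toFun j := Pi.single i (j : ℤ)
  inj' j k h := by simpa using h

variable {d : ℕ} (i : Fin d)

theorem axis_apply (j : ℕ) : axis i j = Pi.single i (j : ℤ) := rfl

theorem axis_apply_self (j : ℕ) : (axis i j i).toNat = j := by simp [axis_apply]

theorem mFourier_axis (j : ℕ) (t : UnitAddTorus (Fin d)) :
    UnitAddTorus.mFourier (axis i j) t = UnitAddTorus.mFourier (axis i 1) t ^ j := by
  induction j with
  | zero =>
    have : axis i 0 = 0 := by simp [axis_apply]
    rw [this, UnitAddTorus.mFourier_zero]
    simp
  | succ j ih =>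
    have : axis i (j + 1) = axis i j + axis i 1 := by
      simp [axis_apply, Pi.single_add]
    rw [this, UnitAddTorus.mFourier_add, ih, pow_succ]

theorem trigPoly_axis (A : Finset ℕ) (c : ℕ → ℂ) (t : UnitAddTorus (Fin d)) :
    trigPoly (A.map (axis i)) (fun k => c (k i).toNat) t
      = ∑ j ∈ A, c j * UnitAddTorus.mFourier (axis i 1) t ^ j := by
  rw [trigPoly_apply, sum_map]
  refine sum_congr rfl fun j _ => ?_
  rw [axis_apply_self, mFourier_axis]

/-- The coefficients of the product of two Dirichlet kernels, of `M` and of `2 * M` terms,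
divided by `M`. -/
noncomputable def vpCoef (M j : ℕ) : ℝ :=
  ((range M).filter fun a => a ≤ j ∧ j < a + 2 * M).card / M

theorem vpCoef_nonneg (M j : ℕ) : 0 ≤ vpCoef M j := by unfold vpCoef; positivity

theorem vpCoef_le_one (M j : ℕ) : vpCoef M j ≤ 1 := by
  refine div_le_one_of_le₀ ?_ (Nat.cast_nonneg _)
  exact_mod_cast (card_filter_le _ _).trans (card_range M).le

theorem vpCoef_eq_one {M j : ℕ} (hM : 0 < M) (h1 : M ≤ j) (h2 : j < 2 * M) : vpCoef M j = 1 := by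
  rw [vpCoef, filter_true_of_mem, card_range, div_self (by exact_mod_cast hM.ne')]
  intro a ha
  rw [mem_range] at ha
  omega

theorem sum_vpCoef (M : ℕ) (z : ℂ) :
    ∑ j ∈ range (3 * M), (vpCoef M j : ℂ) * z ^ j
      = (M : ℂ)⁻¹ * ((∑ a ∈ range M, z ^ a) * ∑ b ∈ range (2 * M), z ^ b) := by
  have h1 : ∀ a ∈ range M, ∑ j ∈ range (3 * M), (if a ≤ j ∧ j < a + 2 * M then z ^ j else 0)
      = z ^ a * ∑ b ∈ range (2 * M), z ^ b := by
    intro a ha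
    rw [mem_range] at ha
    rw [← sum_filter, show (range (3 * M)).filter (fun j => a ≤ j ∧ j < a + 2 * M)
      = Ico a (a + 2 * M) by ext j; simp only [mem_filter, mem_range, mem_Ico]; omega,
      sum_Ico_eq_sum_range, Nat.add_sub_cancel_left, mul_sum]
    exact sum_congr rfl fun b _ => pow_add _ _ _
  rw [sum_mul, ← sum_congr rfl h1, sum_comm, mul_sum]
  refine sum_congr rfl fun j _ => ?_
  rw [← sum_filter, sum_const, nsmul_eq_mul, vpCoef]
  push_cast
  ring

theorem torusNorm_one_vp_le {M : ℕ} (hM : 0 < M) :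
    torusNorm 1 (trigPoly ((range (3 * M)).map (axis i)) fun k => (vpCoef M (k i).toNat : ℂ))
      ≤ 2 := by
  set D : ℕ → TorusC d := fun n => trigPoly ((range n).map (axis i)) fun _ => 1 with hD
  have hDn : ∀ n, torusNorm 2 (D n) = √n := fun n => by
    rw [hD, torusNorm_two]; simp
  have hV : (trigPoly ((range (3 * M)).map (axis i)) fun k => (vpCoef M (k i).toNat : ℂ))
      = (M : ℂ)⁻¹ • (D M * D (2 * M)) := by
    ext t
    have h1 := fun n => trigPoly_axis i (range n) 1 t
    simp only [Pi.one_apply, one_mul] at h1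
    rw [trigPoly_axis i (range (3 * M)) (fun j => (vpCoef M j : ℂ)), sum_vpCoef,
      ContinuousMap.smul_apply, ContinuousMap.mul_apply, smul_eq_mul, hD]
    simp only []
    rw [← h1 M, ← h1 (2 * M)]
  have h2 : eLpNorm (⇑(D M) • ⇑(D (2 * M))) 1 (torusMeasure d) ≤ _ :=
    eLpNorm_smul_le_mul_eLpNorm (p := 2) (q := 2) (r := 1)
      (D (2 * M)).continuous.aestronglyMeasurable (D M).continuous.aestronglyMeasurable
  have h3 := ENNReal.toReal_mono (ENNReal.mul_ne_top (eLpNorm_torus_ne_top 2 (D M))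
    (eLpNorm_torus_ne_top 2 (D (2 * M)))) h2
  rw [ENNReal.toReal_mul] at h3
  have h4 : torusNorm 1 ((M : ℂ)⁻¹ • (D M * D (2 * M)))
      = (M : ℝ)⁻¹ * (eLpNorm (⇑(D M) • ⇑(D (2 * M))) 1 (torusMeasure d)).toReal := by
    rw [torusNorm, ContinuousMap.coe_smul, eLpNorm_const_smul, ENNReal.toReal_mul]
    congr 1
    simp
  have hM' : (0 : ℝ) < M := by exact_mod_cast hM
  rw [hV, h4, inv_mul_le_iff₀ hM']
  refine h3.trans ?_
  change torusNorm 2 (D M) * torusNorm 2 (D (2 * M)) ≤ _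
  rw [hDn, hDn, ← Real.sqrt_mul (Nat.cast_nonneg _)]
  refine Real.sqrt_le_iff.2 ⟨by positivity, ?_⟩
  push_cast
  nlinarith

theorem norm_vp_le (M : ℕ) (t : UnitAddTorus (Fin d)) :
    ‖trigPoly ((range (3 * M)).map (axis i)) (fun k => (vpCoef M (k i).toNat : ℂ)) t‖
      ≤ 2 * M := by
  rw [trigPoly_axis i (range (3 * M)) (fun j => (vpCoef M j : ℂ)), sum_vpCoef]
  have hz := norm_mFourier_apply d (axis i 1) t
  set z := UnitAddTorus.mFourier (axis i 1) t
  have h1 : ∀ n : ℕ, ‖∑ a ∈ range n, z ^ a‖ ≤ n := fun n => by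
    refine (norm_sum_le _ _).trans ?_
    simp [norm_pow, hz]
  rcases Nat.eq_zero_or_pos M with rfl | hM
  · simp
  have hM' : (0 : ℝ) < M := by exact_mod_cast hM
  rw [norm_mul, norm_mul, norm_inv, Complex.norm_natCast, inv_mul_le_iff₀ hM']
  have h2 := h1 (2 * M)
  push_cast at h2
  exact mul_le_mul (h1 M) h2 (norm_nonneg _) hM'.le

theorem exists_flat_trigPoly (i : Fin d) (n : ℕ) :
    ∃ (I J S : Finset (Fin d → ℤ)) (ε v : (Fin d → ℤ) → ℂ),
    I.card = 2 ^ n ∧ J.card = 2 ^ n ∧ I ⊆ S ∧ Disjoint S J ∧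
    (∀ k, ε k = 1 ∨ ε k = -1) ∧ (∀ k, ‖v k‖ ≤ 1) ∧ (∀ k ∈ I, v k = 1) ∧
    (∀ k, (starRingEnd ℂ) (v k) = v k) ∧
    (∀ t, ‖trigPoly I ε t‖ ≤ 2 * ((2 : ℝ) ^ n) ^ (1 / 2 : ℝ)) ∧
    (∀ t, ‖trigPoly J ε t‖ ≤ 2 * ((2 : ℝ) ^ n) ^ (1 / 2 : ℝ)) ∧
    torusNorm 1 (trigPoly S v) ≤ 2 ∧ (∀ t, ‖trigPoly S v t‖ ≤ 2 * 2 ^ n) := by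
  obtain ⟨a, b, ha, -, hab⟩ := exists_rudinShapiro n
  set M : ℕ := 2 ^ n with hM
  have hM0 : 0 < M := by positivity
  have hblock : ∀ (c : ℕ) (t : UnitAddTorus (Fin d)),
      ‖trigPoly ((Ico (M * c) (M * c + M)).map (axis i)) (fun k => a ((k i).toNat % M)) t‖
        ≤ 2 * ((2 : ℝ) ^ n) ^ (1 / 2 : ℝ) := by
    intro c t
    rw [trigPoly_axis i _ (fun j => a (j % M)), sum_Ico_eq_sum_range, Nat.add_sub_cancel_left]
    have hz := norm_mFourier_apply d (axis i 1) t
    set z := UnitAddTorus.mFourier (axis i 1) t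
    have h1 : ∑ k ∈ range M, a ((M * c + k) % M) * z ^ (M * c + k)
        = z ^ (M * c) * ∑ k ∈ range M, a k * z ^ k := by
      rw [mul_sum]
      refine sum_congr rfl fun k hk => ?_
      rw [Nat.mul_add_mod, Nat.mod_eq_of_lt (mem_range.1 hk), pow_add]
      ring
    rw [h1, norm_mul, norm_pow, hz, one_pow, one_mul]
    refine abs_le_of_sq_le_sq' ?_ (by positivity) |>.2
    have h2 := hab z hz
    have h3 : (((2 : ℝ) ^ n) ^ (1 / 2 : ℝ)) ^ 2 = 2 ^ n := by
      rw [← Real.sqrt_eq_rpow, Real.sq_sqrt (by positivity)]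
    rw [mul_pow, h3]
    rw [pow_succ (2 : ℝ) n] at h2
    nlinarith [sq_nonneg ‖∑ k ∈ range M, b k * z ^ k‖, (by positivity : (0 : ℝ) < 2 ^ n)]
  refine ⟨(Ico (M * 1) (M * 1 + M)).map (axis i), (Ico (M * 3) (M * 3 + M)).map (axis i),
    (range (3 * M)).map (axis i), fun k => a ((k i).toNat % M),
    fun k => (vpCoef M (k i).toNat : ℂ), by simp, by simp, ?_, ?_, fun k => ha _, fun k => ?_,
    ?_, fun k => Complex.conj_ofReal _, hblock 1, hblock 3, torusNorm_one_vp_le i hM0, ?_⟩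
  · rw [map_subset_map]
    intro j hj
    rw [mem_Ico] at hj
    rw [mem_range]
    omega
  · rw [disjoint_map, disjoint_left]
    intro j hj hj'
    rw [mem_Ico] at hj'
    rw [mem_range] at hj
    omega
  · rw [Complex.norm_real, Real.norm_of_nonneg (vpCoef_nonneg _ _)]
    exact vpCoef_le_one _ _
  · intro k hk
    obtain ⟨j, hj, rfl⟩ := mem_map.1 hk
    rw [mem_Ico] at hj
    dsimp only
    rw [axis_apply_self, vpCoef_eq_one hM0 (by omega) (by omega), Complex.ofReal_one]
  · intro t
    have := norm_vp_le i M t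
    rw [hM] at this
    push_cast at this
    exact this

end Flat

section TorusSystem

variable {d : ℕ}

theorem torusNorm_vp_rpow_le {q : ℝ≥0∞} (hq : 1 ≤ q) {h : TorusC d} {n : ℕ}
    (h1 : torusNorm 1 h ≤ 2) (h2 : ∀ t, ‖h t‖ ≤ 2 * 2 ^ n) :
    torusNorm q h ≤ 2 * ((2 : ℝ) ^ n) ^ (1 - 1 / q.toReal) := by
  have h3 := torusNorm_le_rpow_mul le_rfl (by simp) hq h2
  rw [ENNReal.toReal_one] at h3
  refine h3.trans ?_
  calc _ ≤ (2 : ℝ) ^ (1 / q.toReal) * (2 * 2 ^ n) ^ (1 - 1 / q.toReal) := by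
        gcongr
        exact torusNorm_nonneg _ _
    _ = (2 : ℝ) ^ (1 / q.toReal) * 2 ^ (1 - 1 / q.toReal)
          * ((2 : ℝ) ^ n) ^ (1 - 1 / q.toReal) := by
        rw [Real.mul_rpow (by norm_num) (by positivity)]; ring
    _ = _ := by
        rw [← Real.rpow_add (by norm_num)]
        simp

theorem one_div_toReal_add {p q : ℝ≥0∞} [hpq : HolderConjugate q p] :
    1 / q.toReal = 1 - 1 / p.toReal := by
  have hp := HolderConjugate.one_le p q
  have hq := HolderConjugate.one_le q p
  have h := congrArg ENNReal.toReal (HolderConjugate.inv_add_inv_eq_one q p)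
  rw [ENNReal.toReal_add (ENNReal.inv_ne_top.2 (zero_lt_one.trans_le hq).ne')
    (ENNReal.inv_ne_top.2 (zero_lt_one.trans_le hp).ne'), ENNReal.toReal_inv, ENNReal.toReal_inv,
    ENNReal.toReal_one] at h
  rw [one_div, one_div]
  linarith

/-- A biorthogonal system whose norms are dominated by those of `L^p` and `L^q`. -/
theorem flatSystem_of_norm_le (hd : 1 ≤ d) {X : Type*} [NormedAddCommGroup X] [NormedSpace ℂ X]
    {e : (Fin d → ℤ) → X} {f : (Fin d → ℤ) → StrongDual ℂ X} {p q : ℝ≥0∞} [HolderConjugate q p]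
    (hef : ∀ k j, f k (e j) = if k = j then 1 else 0)
    (he : ∀ (A : Finset (Fin d → ℤ)) (c : (Fin d → ℤ) → ℂ),
      ‖∑ k ∈ A, c k • e k‖ ≤ torusNorm p (trigPoly A c))
    (hf : ∀ (A : Finset (Fin d → ℤ)) (c : (Fin d → ℤ) → ℂ),
      ‖∑ k ∈ A, c k • f k‖ ≤ torusNorm q (trigPoly A fun k => (starRingEnd ℂ) (c k))) :
    FlatSystem e f (1 - 1 / p.toReal) 2 := by
  have hp := HolderConjugate.one_le p q
  have hq := HolderConjugate.one_le q p
  have hpq := one_div_toReal_add (p := p) (q := q)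
  have hp0 : 0 ≤ 1 / p.toReal := by positivity
  have hq0 : 0 ≤ 1 / q.toReal := by positivity
  refine ⟨by linarith, by linarith, two_pos, fun k => by simp [hef],
    fun k j hkj => by simp [hef, hkj], fun A c => ?_, fun A c => ?_, fun n => ?_⟩
  · rw [show 1 - 1 / p.toReal - 1 / 2 = 1 / 2 - 1 / p.toReal by ring]
    exact (he A c).trans (torusNorm_trigPoly_le p hp A c)
  · rw [← hpq]
    refine (hf A c).trans ((torusNorm_trigPoly_le q hq A _).trans ?_)
    simp only [RCLike.norm_conj, le_refl]
  · obtain ⟨I, J, S, ε, v, h1, h2, h3, h4, h5, h6, h7, h8, h9, h10, h11, h12⟩ :=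
      exists_flat_trigPoly (⟨0, hd⟩ : Fin d) n
    have hε : (fun k => (starRingEnd ℂ) (ε k)) = ε := by
      funext k
      rcases h5 k with h | h <;> simp [h]
    have hv : (fun k => (starRingEnd ℂ) (v k)) = v := funext h8
    refine ⟨I, J, S, ε, v, h1, h2, h3, h4, h5, h6, h7,
      ⟨(he _ _).trans (torusNorm_le_of_bound p h9), (he _ _).trans (torusNorm_le_of_bound p h10),
        (he _ _).trans (torusNorm_vp_rpow_le hp h11 h12)⟩, (hf _ _).trans ?_, (hf _ _).trans ?_,
        (hf _ _).trans ?_⟩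
    · rw [hε]; exact torusNorm_le_of_bound q h9
    · rw [hε]; exact torusNorm_le_of_bound q h10
    · rw [hv, ← hpq]
      exact torusNorm_vp_rpow_le hq h11 h12

theorem conj_trigPoly (A : Finset (Fin d → ℤ)) (c : (Fin d → ℤ) → ℂ) (t : UnitAddTorus (Fin d)) :
    (starRingEnd ℂ) (trigPoly A (fun k => (starRingEnd ℂ) (c k)) t)
      = ∑ k ∈ A, c k * UnitAddTorus.mFourier (-k) t := by
  simp [trigPoly_apply, UnitAddTorus.mFourier_neg]

theorem coefLp_apply (p : ℝ≥0∞) [Fact (1 ≤ p)] (k : Fin d → ℤ) (g : TorusLp d p) :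
    coefLp d p k g = ∫ t, UnitAddTorus.mFourier (-k) t * g t ∂(torusMeasure d) := rfl

theorem coefC_apply (k : Fin d → ℤ) (g : TorusC d) :
    coefC d k g = ∫ t, UnitAddTorus.mFourier (-k) t * g t ∂(torusMeasure d) := rfl

theorem integral_conj_trigPoly_mul (A : Finset (Fin d → ℤ)) (c : (Fin d → ℤ) → ℂ)
    {g : UnitAddTorus (Fin d) → ℂ} (hg : Integrable g (torusMeasure d)) :
    ∫ t, (starRingEnd ℂ) (trigPoly A (fun k => (starRingEnd ℂ) (c k)) t) * g t ∂(torusMeasure d)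
      = ∑ k ∈ A, c k * ∫ t, UnitAddTorus.mFourier (-k) t * g t ∂(torusMeasure d) := by
  simp only [conj_trigPoly, Finset.sum_mul, mul_assoc]
  rw [integral_finsetSum]
  · simp only [integral_const_mul]
  · intro k _
    refine Integrable.const_mul ?_ _
    exact hg.bdd_mul (c := 1) (UnitAddTorus.mFourier (-k)).continuous.aestronglyMeasurable
      (Filter.Eventually.of_forall fun t => (norm_mFourier_apply d _ t).le)

theorem flatSystem_trigLp (hd : 1 ≤ d) (p : ℝ≥0∞) [hp : Fact (1 ≤ p)] :
    FlatSystem (trigLp d p) (coefLp d p) (1 - 1 / p.toReal) 2 := by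
  have := (HolderConjugate.conjExponent hp.out).symm
  refine flatSystem_of_norm_le (q := conjExponent p) hd (fun k j => ?_) (fun A c => ?_)
    (fun A c => ?_)
  · rw [← integral_mFourier_neg_mul, coefLp_apply]
    refine integral_congr_ae ?_
    filter_upwards [ContinuousMap.coeFn_toLp (p := p) (𝕜 := ℂ) (torusMeasure d)
      (UnitAddTorus.mFourier j)] with t ht
    rw [trigLp, ht]
  · rw [sum_trigLp, norm_toLp_eq]
  · refine ContinuousLinearMap.opNorm_le_bound _ (torusNorm_nonneg _ _) fun g => ?_
    rw [_root_.sum_apply]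
    have h1 := norm_integral_conj_mul_le (q := conjExponent p)
      (trigPoly A fun k => (starRingEnd ℂ) (c k)) (Lp.memLp g)
    rw [integral_conj_trigPoly_mul A c ((Lp.memLp g).integrable hp.out), ← Lp.norm_def] at h1
    exact h1

theorem norm_le_torusNorm_top (h : TorusC d) : ‖h‖ ≤ torusNorm ∞ h := by
  refine (ContinuousMap.norm_le _ (torusNorm_nonneg _ _)).2 fun t => ?_
  by_contra! ht
  have hopen : IsOpen {t | torusNorm ∞ h < ‖h t‖} := isOpen_lt continuous_const h.continuous.norm
  refine (hopen.measure_pos (torusMeasure d) ⟨t, ht⟩).ne' ?_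
  have h1 : ∀ᵐ t ∂(torusMeasure d), ‖h t‖ ≤ torusNorm ∞ h := by
    filter_upwards [ae_le_eLpNormEssSup (f := h) (μ := torusMeasure d)] with t ht
    rw [← eLpNorm_exponent_top] at ht
    have := ENNReal.toReal_mono (eLpNorm_torus_ne_top ∞ h) ht
    simpa [torusNorm] using this
  rw [ae_iff] at h1
  simpa using h1

theorem flatSystem_trigC (hd : 1 ≤ d) : FlatSystem (trigC d) (coefC d) 1 2 := by
  have h := flatSystem_of_norm_le (e := trigC d) (f := coefC d) (p := ∞) (q := 1) hd
    (fun k j => ?_) (fun A c => ?_) (fun A c => ?_)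
  · simpa using h
  · rw [← integral_mFourier_neg_mul, coefC_apply]
    rfl
  · exact norm_le_torusNorm_top (trigPoly A c)
  · refine ContinuousLinearMap.opNorm_le_bound _ (torusNorm_nonneg _ _) fun g => ?_
    rw [_root_.sum_apply]
    have hg : MemLp g ∞ (torusMeasure d) :=
      MemLp.of_bound g.continuous.aestronglyMeasurable ‖g‖
        (Filter.Eventually.of_forall fun t => g.norm_coe_le_norm t)
    have h1 := norm_integral_conj_mul_le (q := 1) (p := ∞)
      (trigPoly A fun k => (starRingEnd ℂ) (c k)) hg
    rw [integral_conj_trigPoly_mul A c (hg.integrable le_top)] at h1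
    refine le_trans h1 ?_
    gcongr
    · exact torusNorm_nonneg _ _
    · exact torusNorm_le_of_bound ∞ g.norm_coe_le_norm

theorem norm_trigLp_le (p : ℝ≥0∞) [Fact (1 ≤ p)] (k : Fin d → ℤ) : ‖trigLp d p k‖ ≤ 1 := by
  rw [trigLp, norm_toLp_eq]
  exact torusNorm_le_of_bound p fun t => (norm_mFourier_apply d k t).le

theorem norm_coefLp_le (p : ℝ≥0∞) [Fact (1 ≤ p)] (k : Fin d → ℤ) : ‖coefLp d p k‖ ≤ 1 :=
  LinearMap.mkContinuous_norm_le _ zero_le_one _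

theorem norm_coefC_le (k : Fin d → ℤ) : ‖coefC d k‖ ≤ 1 :=
  LinearMap.mkContinuous_norm_le _ zero_le_one _

end TorusSystem

end GreedyApprox

open GreedyApprox in
theorem proposition8p6 (d : ℕ) (hd : 1 ≤ d) :
    (∀ (p : ENNReal) [Fact (1 ≤ p)], p ≠ ⊤ → p ≠ 2 →
      Approx (minT (upperDemocracy ℂ (trigLp d p)) (upperDemocracy ℂ (coefLp d p)))
        (fun N => (N : ℝ) ^ |1 / p.toReal - 1 / 2|) ∧
      Approx (lebesgueConst (trigLp d p) (coefLp d p))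
        (fun N => (N : ℝ) ^ |1 / p.toReal - 1 / 2|) ∧
      Approx (lebesgueConstTilde (trigLp d p) (coefLp d p))
        (fun N => (N : ℝ) ^ |1 / p.toReal - 1 / 2|) ∧
      Approx (condConst (trigLp d p) (coefLp d p))
        (fun N => (N : ℝ) ^ |1 / p.toReal - 1 / 2|) ∧
      Approx (dualLebesgueConst (trigLp d p) (coefLp d p))
        (fun N => (N : ℝ) ^ |1 / p.toReal - 1 / 2|) ∧
      Approx (dualLebesgueConstTilde (trigLp d p) (coefLp d p))
        (fun N => (N : ℝ) ^ |1 / p.toReal - 1 / 2|)) ∧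
    (
      Approx (minT (upperDemocracy ℂ (trigC d)) (upperDemocracy ℂ (coefC d)))
        (fun N => (N : ℝ) ^ (1 / 2 : ℝ)) ∧
      Approx (lebesgueConst (trigC d) (coefC d))
        (fun N => (N : ℝ) ^ (1 / 2 : ℝ)) ∧
      Approx (lebesgueConstTilde (trigC d) (coefC d))
        (fun N => (N : ℝ) ^ (1 / 2 : ℝ)) ∧
      Approx (condConst (trigC d) (coefC d))
        (fun N => (N : ℝ) ^ (1 / 2 : ℝ)) ∧
      Approx (dualLebesgueConst (trigC d) (coefC d))
        (fun N => (N : ℝ) ^ (1 / 2 : ℝ)) ∧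
      Approx (dualLebesgueConstTilde (trigC d) (coefC d))
        (fun N => (N : ℝ) ^ (1 / 2 : ℝ))) := by
  have : Nonempty (Fin d) := ⟨⟨0, hd⟩⟩
  have : Infinite (Fin d → ℤ) := inferInstance
  refine ⟨fun p hp hp_top hp2 => ?_, ?_⟩
  · refine (flatSystem_trigLp hd p).approx_all ?_ (norm_trigLp_le p) (norm_coefLp_le p)
      (UnitAddTorus.span_mFourierLp_closure_eq_top hp_top) ?_
    · intro h
      apply hp2
      have h1 : p.toReal⁻¹ = 2⁻¹ := by rw [← one_div]; linarith
      rw [← ENNReal.ofReal_toReal hp_top, inv_inj.1 h1]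
      simp
    · rw [← abs_neg]
      congr 1
      ring
  · refine (flatSystem_trigC hd).approx_all (by norm_num)
      (fun k => UnitAddTorus.mFourier_norm.le) norm_coefC_le
      UnitAddTorus.span_mFourier_closure_eq_top ?_
    norm_num
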